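/- **Proposition 4.16 (concentration of the Ritz values).** Let $1\le k\le n$ and let $A$ be an $n\times n$ Hermitian (real symmetric or complex Hermitian) matrix with eigenvalues $\lambda_1,\dots,\lambda_n$, listed with multiplicity; $\|A\|$ denotes its spectral norm. Let $u$ be uniformly distributed on the unit sphere $\mathbb S^{n-1}$ of $\mathbb R^n$. Run the Lanczos algorithm on $A$ from $v_0=u$: for $j\ge 0$ put $W_j=\mathrm{span}\{v_0,\dots,v_j\}$, $\alpha_j(u)=\langle Av_j,v_j\rangle$, $\beta_j(u)=\|\mathrm{Proj}_{W_j^\perp}(Av_j)\|$ and $v_{j+1}=\mathrm{Proj}_{W_j^\perp}(Av_j)/\beta_j(u)$ (if $\beta_j(u)=0$ the algorithm stops, and all later vectors and coefficients are set to $0$; under the assumption below this almost surely does not happen before the $k\times k$ matrix $J_k(u)$ is complete). Let $J_k(u)$ be the $k\times k$ symmetric tridiagonal matrix with diagonal $\alpha_0(u),\dots,\alpha_{k-1}(u)$ and sub- and superdiagonal $\beta_0(u),\dots,\beta_{k-2}(u)$. The vector of Ritz values $\vec r(u)=(r_1(u),\dots,r_k(u))$, $r_1(u)\ge\dots\ge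 r_k(u)$, consists of the eigenvalues of $J_k(u)$. Let $\tilde\alpha_i$ ($0\le i\le k-1$) and $\tilde\beta_i$ ($0\le i\le k-2$) be medians of the random variables $\alpha_i(u)$ and $\beta_i(u)$ (where $m$ is a median of $X$ if $\mathbf P[X\le m]\ge \frac12$ and $\mathbf P[X\ge m]\ge\frac12$), let $\tilde J_k$ be the Jacobi matrix built in the same way from $\tilde\alpha_i,\tilde\beta_i$, and let $\vec r=(\tilde r_1,\dots,\tilde r_k)$, $\tilde r_1\ge\dots\ge\tilde r_k$, be its eigenvalues. Let $\delta,\omega>0$ and assume that the spectrum of $A$ is $(\delta,\omega,k)$-equidistributed: for every nonempty finite set $T$ of at most $k$ real numbers, $$\Big|\Big\{\,i\in\{1,\dots,n\} : \frac1{|T|}\sum_{s\in T}\log|\lambda_i-s|\ \ge\ \log\omega\Big\}\Big|\ \ge\ \delta n\qquad(\log 0=-\infty).$$ Then for every $t>0$, $$\mathbf P\big[\|\vec r(u)-\vec r\|_\infty\ge t\|A\|\big]\ \le\ 4k\left[\exp\left\{-\frac{\min\{\delta,1/50\}^2}{32}\,n\right\}+\exp\left\{-\frac1{192}\Big(\frac{\omega}{4\|A\|}\Big)^{2k}\delta^2t^2n\right\}\right].$$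 -/

import Mathlib

open MeasureTheory

/-- The uniform probability measure on the unit sphere `𝕊ⁿ⁻¹` of `ℝⁿ`: the surface measure
divided by its total mass (meaningful for `n ≥ 1`). -/
noncomputable def unifSphere (n : ℕ) :
    Measure (Metric.sphere (0 : EuclideanSpace ℝ (Fin n)) 1) :=
  ((volume : Measure (EuclideanSpace ℝ (Fin n))).toSphere Set.univ)⁻¹ •
    (volume : Measure (EuclideanSpace ℝ (Fin n))).toSphere

/-- `m` is a median of the real random variable `X` on `(Ω, μ)`:
`P(X ≤ m) ≥ 1/2` and `P(X ≥ m) ≥ 1/2`. -/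
def IsMedian {Ω : Type*} [MeasurableSpace Ω] (μ : Measure Ω) (X : Ω → ℝ) (m : ℝ) : Prop :=
  1 / 2 ≤ μ {x | X x ≤ m} ∧ 1 / 2 ≤ μ {x | m ≤ X x}

/-- The family `Λ` of `n` real numbers (counted with multiplicity) is
`(δ, ω, j)`-equidistributed: for every nonempty finite set `T` of at most `j` real numbers, at
least `δ n` of the indices `i` satisfy `(1 / |T|) ∑ t ∈ T, log |Λ i - t| ≥ log ω`.
Here `log 0 = -∞`, so the inequality fails when `Λ i ∈ T`; since `Real.log 0 = 0`, this is
imposed separately. -/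
def Equidistributed {n : ℕ} (Λ : Fin n → ℝ) (δ ω : ℝ) (j : ℕ) : Prop :=
  ∀ T : Finset ℝ, T.Nonempty → T.card ≤ j →
    δ * (n : ℝ) ≤
      (Set.ncard {i : Fin n | Λ i ∉ T ∧
        Real.log ω ≤ (1 / (T.card : ℝ)) * ∑ t ∈ T, Real.log |Λ i - t|} : ℝ)

/-- The spectral norm (the `ℓ² → ℓ²` operator norm) of a square matrix. -/
noncomputable def matrixSpectralNorm {𝕜 : Type*} [RCLike 𝕜] {n : ℕ}
    (A : Matrix (Fin n) (Fin n) 𝕜) : ℝ :=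
  ‖Matrix.toEuclideanCLM (n := Fin n) (𝕜 := 𝕜) A‖

/-- A point of the real unit sphere, regarded as a vector of `𝕜ⁿ` (`𝕜 = ℝ` or `ℂ`). -/
noncomputable def startVec (𝕜 : Type*) [RCLike 𝕜] {n : ℕ}
    (u : Metric.sphere (0 : EuclideanSpace ℝ (Fin n)) 1) : EuclideanSpace 𝕜 (Fin n) :=
  WithLp.toLp 2 (fun i => ((u.1 i : ℝ) : 𝕜))

/-- The vectors `v_j` of the Lanczos algorithm with input `A` and `u`: `v_0 = u` and `v_{j+1}` is
the normalization of the projection of `A v_j` onto the orthogonal complement of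
`W_j = span {v_0, …, v_j}`. If that projection is `0`, so that the algorithm stops, all later
vectors are `0`. -/
noncomputable def lanczosVec {𝕜 : Type*} [RCLike 𝕜] {n : ℕ} (A : Matrix (Fin n) (Fin n) 𝕜)
    (u : EuclideanSpace 𝕜 (Fin n)) : ℕ → EuclideanSpace 𝕜 (Fin n)
  | 0 => u
  | j + 1 =>
    let w := (Submodule.span 𝕜 (Set.range fun i : Fin (j + 1) =>
      lanczosVec A u i.1))ᗮ.starProjection
        (Matrix.toEuclideanCLM (n := Fin n) (𝕜 := 𝕜) A (lanczosVec A u j))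
    ((‖w‖⁻¹ : ℝ) : 𝕜) • w
  termination_by j => j
  decreasing_by
    · exact i.2
    · exact Nat.lt_succ_self j

/-- The Jacobi coefficient `α_j = ⟨A v_j, v_j⟩` (a real number when `A` is Hermitian). -/
noncomputable def lanczosAlpha {𝕜 : Type*} [RCLike 𝕜] {n : ℕ} (A : Matrix (Fin n) (Fin n) 𝕜)
    (j : ℕ) (u : Metric.sphere (0 : EuclideanSpace ℝ (Fin n)) 1) : ℝ :=
  RCLike.re (inner 𝕜
    (Matrix.toEuclideanCLM (n := Fin n) (𝕜 := 𝕜) A (lanczosVec A (startVec 𝕜 u) j))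
    (lanczosVec A (startVec 𝕜 u) j))

/-- The Jacobi coefficient `β_j = ‖Proj_{W_jᗮ} (A v_j)‖`, `W_j = span {v_0, …, v_j}`. -/
noncomputable def lanczosBeta {𝕜 : Type*} [RCLike 𝕜] {n : ℕ} (A : Matrix (Fin n) (Fin n) 𝕜)
    (j : ℕ) (u : Metric.sphere (0 : EuclideanSpace ℝ (Fin n)) 1) : ℝ :=
  ‖(Submodule.span 𝕜 (Set.range fun i : Fin (j + 1) =>
      lanczosVec A (startVec 𝕜 u) i.1))ᗮ.starProjection
    (Matrix.toEuclideanCLM (n := Fin n) (𝕜 := 𝕜) A (lanczosVec A (startVec 𝕜 u) j))‖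

/-- The symmetric tridiagonal `k × k` matrix with diagonal entries `a 0, …, a (k - 1)` and
sub- and superdiagonal entries `b 0, …, b (k - 2)`. -/
def jacobiMatrix (k : ℕ) (a b : ℕ → ℝ) : Matrix (Fin k) (Fin k) ℝ :=
  Matrix.of fun i j =>
    if i.1 = j.1 then a i.1
    else if i.1 + 1 = j.1 then b i.1
    else if j.1 + 1 = i.1 then b j.1
    else 0

theorem jacobiMatrix_isHermitian (k : ℕ) (a b : ℕ → ℝ) : (jacobiMatrix k a b).IsHermitian := by
  ext i j
  simp only [jacobiMatrix, Matrix.conjTranspose_apply, Matrix.of_apply, star_trivial]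
  rcases lt_trichotomy i.1 j.1 with h | h | h
  · have h1 : ¬ j.1 = i.1 := by omega
    have h2 : ¬ i.1 = j.1 := by omega
    have h3 : ¬ j.1 + 1 = i.1 := by omega
    simp [h1, h2, h3]
  · simp [h]
  · have h1 : ¬ j.1 = i.1 := by omega
    have h2 : ¬ i.1 = j.1 := by omega
    have h3 : ¬ i.1 + 1 = j.1 := by omega
    simp [h1, h2, h3]

/-- The eigenvalues `r_1 ≥ ⋯ ≥ r_k`, with multiplicity and in decreasing order, of the
`k × k` Jacobi matrix with coefficients `a`, `b`. -/
noncomputable def jacobiEigenvalues (k : ℕ) (a b : ℕ → ℝ) : Fin k → ℝ :=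
  fun i => (jacobiMatrix_isHermitian k a b).eigenvalues₀
    (Fin.cast (Fintype.card_fin k).symm i)

/-- The vector of Ritz values `r_1(u) ≥ ⋯ ≥ r_k(u)` of the Lanczos algorithm after `k`
iterations: the eigenvalues of `J_k(u)`. -/
noncomputable def ritzValues {𝕜 : Type*} [RCLike 𝕜] {n : ℕ} (A : Matrix (Fin n) (Fin n) 𝕜)
    (k : ℕ) (u : Metric.sphere (0 : EuclideanSpace ℝ (Fin n)) 1) : Fin k → ℝ :=
  jacobiEigenvalues k (fun j => lanczosAlpha A j u) (fun j => lanczosBeta A j u)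

open Set
open scoped ENNReal Pointwise

/-! Write D_j(u) = β_0⋯β_{j-1} and R = ‖A‖. Then D_j v_j = q_j(A)u with q_j monic of degree j, and
D_j is the minimum of ‖p(A)u‖ over all such monic p. One may take q_j with all roots in [-R, R]
(`exists_rootPoly_aeval_eq_lanczosProd_smul`), whence ‖q_j(A)‖ ≤ (2R)^j. This variational
description makes D_j Lipschitz in u. Where moreover D_i ≥ ω^i m for i ≤ j, orthogonality of q_j(A)u
to lower-degree polynomials makes α_j and β_j Lipschitz with constant of order R(2R/ω)^j/m
(`abs_alpha_sub_le`, `abs_norm_lanczosDir_sub_le`).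

The lower bound on D_j holds for most u. For a fixed p with j distinct real roots, equidistribution
yields at least δn eigenvalues with |p(λ)| ≥ ω^j. A random real unit vector has mass more than δ/4
on the corresponding eigenvectors outside an event of probability exp(-δn/6), by a Gaussian Chernoff
bound (`unifSphere_sum_norm_inner_sq_le`). A union bound over a grid of root vectors then covers the
random polynomial q_j and gives m = √δ/4 (`unifSphere_lanczosProd_lt_le`).

Concentration comes from Prékopa–Leindler applied to cones over two separated subsets of the sphere
(`unifSphere_mul_le`). It needs no extension of Lipschitz functions: if f is Lipschitz only on a set
G of measure at least 3/4, the median half-space still meets G in measure at least 1/4. Weyl's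
inequality carries the deviation of the α_i and β_i over to the eigenvalues of the Jacobi matrix.

In the final count the claim is trivial if its right side is at least 1, and the event is empty if t
> 6. Otherwise n is large enough to pay for the grid, and the concentration exponent is twice the
claimed one, which absorbs the excess constant. -/

/-! ### Brunn–Minkowski on the line and the Prékopa–Leindler inequality. -/

theorem Real.volume_add_volume_le_of_isCompact {K L : Set ℝ} (hK : IsCompact K) (hL : IsCompact L)
    (hK0 : K.Nonempty) (hL0 : L.Nonempty) {C : Set ℝ} (hC : K + L ⊆ C) :
    volume K + volume L ≤ volume C := by
  set a := sSup K
  set b := sInf L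
  have ha : a ∈ K := hK.sSup_mem hK0
  have hb : b ∈ L := hL.sInf_mem hL0
  have hdis : AEDisjoint volume ((fun x => x + b) '' K) ((fun x => a + x) '' L) := by
    -- The translate K + min L lies to the left of max K + min L and max K + L lies to its right, so
    -- they share at most that one point.
    refine measure_mono_null (t := {a + b}) ?_ (by simp)
    rintro z ⟨⟨x, hx, rfl⟩, ⟨y, hy, hxy⟩⟩
    have h1 : x ≤ a := le_csSup hK.bddAbove hx
    have h2 : b ≤ y := csInf_le hL.bddBelow hy
    have h3 : a + y = x + b := hxy
    simp only [mem_singleton_iff]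
    linarith
  have hL' : IsCompact ((fun x => a + x) '' L) := hL.image (by fun_prop)
  calc volume K + volume L
      = volume ((fun x => x + b) '' K) + volume ((fun x => a + x) '' L) := by
        simp [image_add_right, image_add_left]
    _ = volume (((fun x => x + b) '' K) ∪ ((fun x => a + x) '' L)) :=
        (measure_union₀ hL'.measurableSet.nullMeasurableSet hdis).symm
    _ ≤ volume C := by
        apply measure_mono
        refine Subset.trans ?_ hC
        rintro z (⟨x, hx, rfl⟩ | ⟨y, hy, rfl⟩)
        · exact add_mem_add hx hb
        · exact add_mem_add ha hy

/-- The one-dimensional Brunn–Minkowski inequality. -/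
theorem Real.volume_add_volume_le {A B C : Set ℝ} (hA : MeasurableSet A) (hB : MeasurableSet B)
    (hA0 : A.Nonempty) (hB0 : B.Nonempty) (hC : A + B ⊆ C) :
    volume A + volume B ≤ volume C := by
  obtain ⟨a, ha⟩ := hA0
  obtain ⟨b, hb⟩ := hB0
  rw [hA.measure_eq_iSup_isCompact, hB.measure_eq_iSup_isCompact]
  simp_rw [iSup_and']
  refine ENNReal.biSup_add_biSup_le' (p := fun K => K ⊆ A ∧ IsCompact K)
    (q := fun K => K ⊆ B ∧ IsCompact K) ⟨∅, by simp⟩ ⟨∅, by simp⟩ ?_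
  rintro K ⟨hKA, hK⟩ L ⟨hLB, hL⟩
  -- Inner regularity also ranges over empty compact sets, for which the compact case fails;
  -- adjoining a point of A and one of B repairs this.
  calc volume K + volume L ≤ volume (insert a K) + volume (insert b L) := by
        gcongr <;> exact subset_insert _ _
    _ ≤ volume C := by
        refine Real.volume_add_volume_le_of_isCompact (hK.insert a) (hL.insert b)
          (insert_nonempty _ _) (insert_nonempty _ _) (Subset.trans ?_ hC)
        exact add_subset_add (insert_subset ha hKA) (insert_subset hb hLB)

/-- With both suprema normalized to 1, the superlevel sets of f and g at height s < 1 are nonempty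
and half their sum lies in that of h. The one-dimensional Brunn–Minkowski inequality at each height,
integrated over s, gives this additive form. -/
theorem prekopaLeindler_aux {f g h : ℝ → ℝ} (hf : Measurable f) (hg : Measurable g)
    (hf0 : ∀ x, 0 ≤ f x) (hg0 : ∀ x, 0 ≤ g x) (hh : Measurable h) (hh0 : ∀ x, 0 ≤ h x)
    (hf1 : ∀ x, f x ≤ 1) (hg1 : ∀ x, g x ≤ 1)
    (hfs : ∀ s < 1, ∃ x, s < f x) (hgs : ∀ s < 1, ∃ x, s < g x)
    (hfg : ∀ x y, f x * g y ≤ h ((x + y) / 2) ^ 2) :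
    (∫⁻ x, ENNReal.ofReal (f x)) + ∫⁻ x, ENNReal.ofReal (g x) ≤
      2 * ∫⁻ x, ENNReal.ofReal (h x) := by
  rw [lintegral_eq_lintegral_meas_lt _ (.of_forall hf0) hf.aemeasurable,
    lintegral_eq_lintegral_meas_lt _ (.of_forall hg0) hg.aemeasurable,
    lintegral_eq_lintegral_meas_lt _ (.of_forall hh0) hh.aemeasurable]
  have hanti : ∀ φ : ℝ → ℝ, Measurable fun t => volume {a | t < φ a} := fun φ =>
    Antitone.measurable fun s t hst => measure_mono fun x hx => lt_of_le_of_lt hst hx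
  rw [← lintegral_add_left (hanti f), ← lintegral_const_mul _ (hanti h)]
  refine setLIntegral_mono ((hanti h).const_mul _) fun s hs => ?_
  have hs : 0 < s := hs
  by_cases h1 : s < 1
  · calc volume {a | s < f a} + volume {a | s < g a}
        ≤ volume ((fun x => (1 / 2 : ℝ) * x) ⁻¹' {a | s < h a}) := by
          refine Real.volume_add_volume_le (measurableSet_lt measurable_const hf)
            (measurableSet_lt measurable_const hg) (hfs s h1) (hgs s h1) ?_
          rintro _ ⟨x, hx, y, hy, rfl⟩
          simp only [mem_ofPred_eq, mem_preimage] at hx hy ⊢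
          have h2 := hfg x y
          have h3 : s * s < f x * g y := mul_lt_mul'' hx hy hs.le hs.le
          have h4 := hh0 ((x + y) / 2)
          rw [show (1 / 2 : ℝ) * (x + y) = (x + y) / 2 by ring]
          nlinarith
      _ = 2 * volume {a | s < h a} := by
          rw [Real.volume_preimage_mul_left (by norm_num)]
          norm_num
  · have e1 : {a | s < f a} = ∅ := by
      ext x; simpa using (hf1 x).trans (not_lt.1 h1)
    have e2 : {a | s < g a} = ∅ := by
      ext x; simpa using (hg1 x).trans (not_lt.1 h1)
    simp [e1, e2]

/-- Rescaling f, g, h by sup f, sup g and the root of their product reduces to normalized suprema;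
the arithmetic-geometric mean inequality then turns the sum into a product. -/
theorem prekopaLeindler_of_bounded {f g h : ℝ → ℝ} (hf : Measurable f) (hg : Measurable g)
    (hf0 : ∀ x, 0 ≤ f x) (hg0 : ∀ x, 0 ≤ g x) (hh : Measurable h) (hh0 : ∀ x, 0 ≤ h x)
    (hfb : BddAbove (range f)) (hgb : BddAbove (range g))
    (hfg : ∀ x y, f x * g y ≤ h ((x + y) / 2) ^ 2) :
    (∫⁻ x, ENNReal.ofReal (f x)) * ∫⁻ x, ENNReal.ofReal (g x) ≤
      (∫⁻ x, ENNReal.ofReal (h x)) ^ 2 := by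
  by_cases hfz : ∀ x, f x = 0
  · simp [hfz]
  by_cases hgz : ∀ x, g x = 0
  · simp [hgz]
  push Not at hfz hgz
  obtain ⟨x₀, hx₀⟩ := hfz
  obtain ⟨y₀, hy₀⟩ := hgz
  set a := sSup (range f)
  set b := sSup (range g)
  have hfa : ∀ x, f x ≤ a := fun x => le_csSup hfb (mem_range_self x)
  have hgb' : ∀ x, g x ≤ b := fun x => le_csSup hgb (mem_range_self x)
  have ha : 0 < a := lt_of_lt_of_le (lt_of_le_of_ne (hf0 x₀) hx₀.symm) (hfa x₀)
  have hb : 0 < b := lt_of_lt_of_le (lt_of_le_of_ne (hg0 y₀) hy₀.symm) (hgb' y₀)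
  set c := Real.sqrt (a * b)
  have hc : 0 < c := Real.sqrt_pos.2 (mul_pos ha hb)
  have hc2 : c ^ 2 = a * b := Real.sq_sqrt (mul_pos ha hb).le
  have key := prekopaLeindler_aux (f := fun x => a⁻¹ * f x) (g := fun x => b⁻¹ * g x)
    (h := fun x => c⁻¹ * h x) (hf.const_mul _) (hg.const_mul _)
    (fun x => mul_nonneg (inv_nonneg.2 ha.le) (hf0 x))
    (fun x => mul_nonneg (inv_nonneg.2 hb.le) (hg0 x)) (hh.const_mul _)
    (fun x => mul_nonneg (inv_nonneg.2 hc.le) (hh0 x))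
    (fun x => by rw [inv_mul_le_iff₀ ha]; simpa using hfa x)
    (fun x => by rw [inv_mul_le_iff₀ hb]; simpa using hgb' x)
    (fun s hs => by
      obtain ⟨_, ⟨x, rfl⟩, hx⟩ := exists_lt_of_lt_csSup (range_nonempty f)
        (show a * s < a by nlinarith)
      exact ⟨x, by rwa [lt_inv_mul_iff₀ ha]⟩)
    (fun s hs => by
      obtain ⟨_, ⟨x, rfl⟩, hx⟩ := exists_lt_of_lt_csSup (range_nonempty g)
        (show b * s < b by nlinarith)
      exact ⟨x, by rwa [lt_inv_mul_iff₀ hb]⟩)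
    (fun x y => by
      have := hfg x y
      rw [mul_pow, inv_pow, hc2, mul_inv, mul_mul_mul_comm]
      exact mul_le_mul_of_nonneg_left this (by positivity))
  have hsc : ∀ (r : ℝ), 0 < r → ∀ φ : ℝ → ℝ, Measurable φ →
      ∫⁻ x, ENNReal.ofReal (φ x) = ENNReal.ofReal r * ∫⁻ x, ENNReal.ofReal (r⁻¹ * φ x) := by
    intro r hr φ hφ
    rw [← lintegral_const_mul _ (by fun_prop)]
    congr 1 with x
    rw [← ENNReal.ofReal_mul hr.le, mul_inv_cancel_left₀ hr.ne']
  rw [hsc a ha f hf, hsc b hb g hg, hsc c hc h hh]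
  generalize (∫⁻ x, ENNReal.ofReal (a⁻¹ * f x)) = I at key ⊢
  generalize (∫⁻ x, ENNReal.ofReal (b⁻¹ * g x)) = J at key ⊢
  generalize (∫⁻ x, ENNReal.ofReal (c⁻¹ * h x)) = H at key ⊢
  have hIJ : I * J ≤ H ^ 2 := by
    by_cases hH : H = ∞
    · simp [hH]
    have hIH : I ≤ 2 * H := le_self_add.trans key
    have hJH : J ≤ 2 * H := le_add_self.trans key
    lift H to NNReal using hH with H'
    lift I to NNReal using (hIH.trans_lt (by finiteness)).ne
    lift J to NNReal using (hJH.trans_lt (by finiteness)).ne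
    norm_cast at key ⊢
    have key' : (I : ℝ) + J ≤ 2 * H' := by exact_mod_cast key
    have : (I : ℝ) * J ≤ H' ^ 2 := by nlinarith [sq_nonneg ((I : ℝ) - J), I.2, J.2, H'.2, I.coe_nonneg, J.coe_nonneg]
    exact_mod_cast this
  calc ENNReal.ofReal a * I * (ENNReal.ofReal b * J)
      = ENNReal.ofReal (c ^ 2) * (I * J) := by
        rw [hc2, ENNReal.ofReal_mul ha.le]; ring
    _ ≤ ENNReal.ofReal (c ^ 2) * H ^ 2 := by gcongr
    _ = _ := by rw [ENNReal.ofReal_pow hc.le]; ring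

/-- The Prékopa–Leindler inequality on `ℝ` (at the midpoint). -/
theorem prekopaLeindler_real {f g h : ℝ → ℝ≥0∞} (hf : Measurable f) (hg : Measurable g)
    (hh : Measurable h) (hfg : ∀ x y, f x * g y ≤ h ((x + y) / 2) ^ 2) :
    (∫⁻ x, f x) * ∫⁻ x, g x ≤ (∫⁻ x, h x) ^ 2 := by
  have hsup : ∀ φ : ℝ → ℝ≥0∞, Measurable φ →
      ∫⁻ x, φ x = ⨆ N : ℕ, ∫⁻ x, min (φ x) N := by
    intro φ hφ
    rw [← lintegral_iSup (fun N => hφ.min measurable_const)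
      (fun i j hij x => min_le_min le_rfl (by exact_mod_cast hij))]
    congr 1 with x
    rw [← inf_iSup_eq, ENNReal.iSup_natCast, inf_top_eq]
  have hfin : ∀ (N : ℕ) (a : ℝ≥0∞), min a N ≠ ∞ := fun N a =>
    ((min_le_right _ _).trans_lt (ENNReal.natCast_lt_top N)).ne
  have hreal : ∀ (N : ℕ) (φ : ℝ → ℝ≥0∞),
      ∫⁻ x, min (φ x) N = ∫⁻ x, ENNReal.ofReal (min (φ x) N).toReal := by
    intro N φ
    congr 1 with x
    rw [ENNReal.ofReal_toReal (hfin N _)]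
  have hmono : ∀ φ : ℝ → ℝ≥0∞, Monotone fun N : ℕ => ∫⁻ x, min (φ x) N :=
    fun φ i j hij => lintegral_mono fun x => min_le_min le_rfl (by exact_mod_cast hij)
  rw [hsup f hf, hsup g hg, ENNReal.iSup_mul]
  refine iSup_le fun i => ?_
  rw [ENNReal.mul_iSup]
  refine iSup_le fun j => ?_
  refine (mul_le_mul' (hmono f (le_max_left i j)) (hmono g (le_max_right i j))).trans ?_
  · set N := max i j
    calc (∫⁻ x, min (f x) N) * ∫⁻ x, min (g x) N ≤ (∫⁻ x, min (h x) N) ^ 2 := by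
          simp_rw [hreal N]
          have hb : ∀ φ : ℝ → ℝ≥0∞, BddAbove (range fun x => (min (φ x) (N : ℝ≥0∞)).toReal) := by
            refine fun φ => ⟨N, ?_⟩
            rintro _ ⟨x, rfl⟩
            exact ENNReal.toReal_le_of_le_ofReal (by positivity) (by simp)
          refine prekopaLeindler_of_bounded (hf.min measurable_const).ennreal_toReal
            (hg.min measurable_const).ennreal_toReal (fun _ => ENNReal.toReal_nonneg)
            (fun _ => ENNReal.toReal_nonneg) (hh.min measurable_const).ennreal_toReal
            (fun _ => ENNReal.toReal_nonneg) (hb f) (hb g) fun x y => ?_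
          rw [← ENNReal.toReal_mul, ← ENNReal.toReal_pow]
          refine ENNReal.toReal_mono (ENNReal.pow_ne_top (hfin N _)) ?_
          -- Truncation of all three functions at the same N preserves the hypothesis: where h
          -- exceeds N, the truncated product is at most N² anyway.
          rcases le_total (h ((x + y) / 2)) N with h1 | h1
          · rw [min_eq_left h1]
            exact (mul_le_mul' (min_le_left _ _) (min_le_left _ _)).trans (hfg x y)
          · rw [min_eq_right h1, sq]
            exact mul_le_mul' (min_le_right _ _) (min_le_right _ _)
      _ ≤ _ := by
          gcongr
          exact min_le_left _ _

/-- The Prékopa–Leindler inequality on `ℝⁿ` (at the midpoint). -/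
theorem prekopaLeindler_pi (n : ℕ) {f g h : (Fin n → ℝ) → ℝ≥0∞} (hf : Measurable f)
    (hg : Measurable g) (hh : Measurable h)
    (hfg : ∀ x y, f x * g y ≤ h ((1 / 2 : ℝ) • (x + y)) ^ 2) :
    (∫⁻ x, f x) * ∫⁻ x, g x ≤ (∫⁻ x, h x) ^ 2 := by
  induction n with
  | zero =>
    have e : ∀ φ : (Fin 0 → ℝ) → ℝ≥0∞, ∫⁻ x, φ x = φ default := by
      intro φ
      rw [lintegral_unique, Measure.volume_pi_eq_dirac default, measure_univ, mul_one]
      congr 1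
      exact Subsingleton.elim _ _
    rw [e, e, e]
    convert hfg default default
  | succ n ih =>
    have mp := (volume_preserving_piFinSuccAbove (fun _ : Fin (n + 1) => ℝ) 0).symm
    have hcons : ∀ (a : ℝ) (z : Fin n → ℝ),
        (MeasurableEquiv.piFinSuccAbove (fun _ : Fin (n + 1) => ℝ) 0).symm (a, z) =
          (Fin.cons a z : Fin (n + 1) → ℝ) := fun a z => Fin.insertNth_zero' a z
    have e : ∀ φ : (Fin (n + 1) → ℝ) → ℝ≥0∞, Measurable φ →
        ∫⁻ x, φ x = ∫⁻ a : ℝ, ∫⁻ z : Fin n → ℝ, φ (Fin.cons a z) := by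
      intro φ hφ
      rw [← mp.lintegral_comp hφ, Measure.volume_eq_prod, lintegral_prod]
      · simp_rw [hcons]
      · exact (hφ.comp mp.measurable).aemeasurable
    have hmeas : ∀ φ : (Fin (n + 1) → ℝ) → ℝ≥0∞, Measurable φ →
        Measurable fun p : ℝ × (Fin n → ℝ) => φ (Fin.cons p.1 p.2) :=
      fun φ hφ => by
        convert hφ.comp mp.measurable using 2 with p
        exact congrArg φ (hcons p.1 p.2).symm
    rw [e f hf, e g hg, e h hh]
    refine prekopaLeindler_real (hmeas f hf).lintegral_prod_right'
      (hmeas g hg).lintegral_prod_right' (hmeas h hh).lintegral_prod_right' fun a b => ?_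
    refine ih ((hmeas f hf).comp (by fun_prop : Measurable fun z => (a, z)))
      ((hmeas g hg).comp (by fun_prop : Measurable fun z => (b, z)))
      ((hmeas h hh).comp (by fun_prop : Measurable fun z => ((a + b) / 2, z))) fun x y => ?_
    convert hfg (Fin.cons a x) (Fin.cons b y) using 3
    ext i
    refine Fin.cases ?_ (fun j => ?_) i
    · simp; ring
    · simp; ring

theorem prekopaLeindler_euclideanSpace {n : ℕ} {f g h : EuclideanSpace ℝ (Fin n) → ℝ≥0∞}
    (hf : Measurable f) (hg : Measurable g) (hh : Measurable h)
    (hfg : ∀ x y, f x * g y ≤ h ((1 / 2 : ℝ) • (x + y)) ^ 2) :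
    (∫⁻ x, f x) * ∫⁻ x, g x ≤ (∫⁻ x, h x) ^ 2 := by
  have mp := PiLp.volume_preserving_toLp (Fin n)
  rw [← mp.lintegral_comp hf, ← mp.lintegral_comp hg, ← mp.lintegral_comp hh]
  exact prekopaLeindler_pi n (hf.comp mp.measurable) (hg.comp mp.measurable)
    (hh.comp mp.measurable) fun x y => hfg _ _

/-! ### Concentration of measure on the sphere. -/

theorem measurableSet_Ioo_smul_sphere {E : Type*} [NormedAddCommGroup E] [NormedSpace ℝ E]
    [MeasurableSpace E] [BorelSpace E] [SecondCountableTopology E]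
    {s : Set (Metric.sphere (0 : E) 1)} (hs : MeasurableSet s) :
    MeasurableSet (Ioo (0 : ℝ) 1 • ((↑) '' s : Set E)) := by
  have : Ioo (0 : ℝ) 1 • ((↑) '' s : Set E) =
      Subtype.val '' (homeomorphUnitSphereProd E ⁻¹' s ×ˢ Iio ⟨1, mem_Ioi.2 one_pos⟩) := by
    rw [← image2_smul, image2_image_right, ← Homeomorph.image_symm, image_image,
      ← image_subtype_val_Ioi_Iio (a := (0 : ℝ)) ⟨1, mem_Ioi.2 one_pos⟩, image2_image_left,
      image2_swap, ← image_prod]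
    rfl
  rw [this, (MeasurableEmbedding.subtype_coe (measurableSet_singleton _).compl).measurableSet_image]
  exact (homeomorphUnitSphereProd E).continuous.measurable (hs.prod measurableSet_Iio)

theorem unifSphere_apply {n : ℕ} (hn : 0 < n)
    {s : Set (Metric.sphere (0 : EuclideanSpace ℝ (Fin n)) 1)} (hs : MeasurableSet s) :
    unifSphere n s = volume (Ioo (0 : ℝ) 1 • ((↑) '' s : Set (EuclideanSpace ℝ (Fin n)))) /
      volume (Metric.ball (0 : EuclideanSpace ℝ (Fin n)) 1) := by
  have hn' : (n : ℝ≥0∞) ≠ 0 := by exact_mod_cast hn.ne'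
  rw [unifSphere, Measure.smul_apply, Measure.toSphere_apply' _ hs, Measure.toSphere_apply_univ,
    finrank_euclideanSpace, Fintype.card_fin, smul_eq_mul, mul_comm, ← div_eq_mul_inv,
    ENNReal.mul_div_mul_left _ _ hn' (ENNReal.natCast_ne_top n)]

theorem unifSphere_univ {n : ℕ} (hn : 0 < n) : unifSphere n univ = 1 := by
  have : Nonempty (Fin n) := ⟨⟨0, hn⟩⟩
  rw [unifSphere, Measure.smul_apply, smul_eq_mul]
  exact ENNReal.inv_mul_cancel (by simpa only [ne_eq, Measure.measure_univ_eq_zero] using Measure.toSphere_ne_zero _) (measure_ne_top _ _)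

/-- With p = ⟨b, c⟩ ≤ 1 - ε²/2, the squared norm is (r² + s² + 2rsp)/4, at most (1 + rs(3 - ε²))/4.
If ε² ≤ 3 this is at most 1 - ε²/4 ≤ exp(-ε²/4). Otherwise it is at most 1/4, which suffices because
ε ≤ 2 and 1/4 ≤ exp(-1). -/
theorem norm_midpoint_smul_le {E : Type*} [NormedAddCommGroup E] [InnerProductSpace ℝ E]
    {b c : E} (hb : ‖b‖ = 1) (hc : ‖c‖ = 1) {ε : ℝ} (hε : 0 ≤ ε) (hbc : ε ≤ ‖b - c‖)
    {r s : ℝ} (hr : r ∈ Icc (0 : ℝ) 1) (hs : s ∈ Icc (0 : ℝ) 1) :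
    ‖(1 / 2 : ℝ) • (r • b + s • c)‖ ≤ Real.exp (-(ε ^ 2 / 8)) := by
  obtain ⟨hr0, hr1⟩ := hr
  obtain ⟨hs0, hs1⟩ := hs
  have hε2 : ε ≤ 2 := hbc.trans ((norm_sub_le _ _).trans (by rw [hb, hc]; norm_num))
  have h1 : ‖b - c‖ ^ 2 = 2 - 2 * inner ℝ b c := by
    rw [norm_sub_sq_real, hb, hc]; ring
  set p : ℝ := inner ℝ b c
  have hp : p ≤ 1 - ε ^ 2 / 2 := by nlinarith
  have h2 : ‖(1 / 2 : ℝ) • (r • b + s • c)‖ ^ 2 = (r ^ 2 + s ^ 2 + 2 * (r * s * p)) / 4 := by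
    rw [norm_smul, mul_pow, norm_add_sq_real, norm_smul, norm_smul, hb, hc, inner_smul_left,
      inner_smul_right]
    simp only [Real.norm_eq_abs, mul_one, sq_abs, conj_trivial]
    ring
  have hrs : 0 ≤ r * s := mul_nonneg hr0 hs0
  have hrs1 : r * s ≤ 1 := mul_le_one₀ hr1 hs0 hs1
  have h3 : Real.exp (-(ε ^ 2 / 8)) ^ 2 = Real.exp (-(ε ^ 2 / 4)) := by
    rw [← Real.exp_nat_mul]; congr 1; push_cast; ring
  -- The expression is concave in each variable and nonnegative at the four corners of the unit
  -- square.
  have hq : 0 ≤ 1 - r ^ 2 - s ^ 2 + r * s := by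
    nlinarith [mul_nonneg hr0 (sub_nonneg.2 hr1), mul_nonneg hs0 (sub_nonneg.2 hs1),
      mul_nonneg (sub_nonneg.2 hr1) (sub_nonneg.2 hs1), mul_nonneg hrs (sub_nonneg.2 hr1),
      mul_nonneg hrs (sub_nonneg.2 hs1)]
  refine (sq_le_sq₀ (norm_nonneg _) (Real.exp_pos _).le).1 ?_
  rw [h2, h3]
  have e1 : 1 - ε ^ 2 / 4 ≤ Real.exp (-(ε ^ 2 / 4)) := by
    have := Real.add_one_le_exp (-(ε ^ 2 / 4)); linarith
  have e2 : (1 : ℝ) / 4 ≤ Real.exp (-(ε ^ 2 / 4)) := by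
    have a1 : Real.exp (-1) ≤ Real.exp (-(ε ^ 2 / 4)) := Real.exp_le_exp.2 (by nlinarith)
    have a2 : (1 : ℝ) / 4 ≤ Real.exp (-1) := by
      have := Real.exp_neg_one_gt_d9; linarith
    linarith
  have h4 : r * s * p ≤ r * s * (1 - ε ^ 2 / 2) := mul_le_mul_of_nonneg_left hp hrs
  by_cases h5 : (0 : ℝ) ≤ 3 / 2 - ε ^ 2 / 2
  · nlinarith [mul_nonneg h5 (sub_nonneg.2 hrs1)]
  · push Not at h5
    nlinarith [mul_nonneg hrs (neg_nonneg.2 h5.le)]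

/-- The concentration of measure on the sphere, for closed sets at distance `ε`. -/
theorem unifSphere_mul_le_of_isClosed {n : ℕ} (hn : 0 < n)
    {B C : Set (Metric.sphere (0 : EuclideanSpace ℝ (Fin n)) 1)} (hB : IsClosed B)
    (hC : IsClosed C) {ε : ℝ} (hε : 0 ≤ ε) (hBC : ∀ b ∈ B, ∀ c ∈ C, ε ≤ dist b c) :
    unifSphere n B * unifSphere n C ≤ ENNReal.ofReal (Real.exp (-(n * ε ^ 2 / 4))) := by
  set B' := Ioo (0 : ℝ) 1 • ((↑) '' B : Set (EuclideanSpace ℝ (Fin n)))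
  set C' := Ioo (0 : ℝ) 1 • ((↑) '' C : Set (EuclideanSpace ℝ (Fin n)))
  set ρ := Real.exp (-(ε ^ 2 / 8))
  set D := Metric.closedBall (0 : EuclideanSpace ℝ (Fin n)) ρ
  have hB' : MeasurableSet B' := measurableSet_Ioo_smul_sphere hB.measurableSet
  have hC' : MeasurableSet C' := measurableSet_Ioo_smul_sphere hC.measurableSet
  have hD : MeasurableSet D := Metric.isClosed_closedBall.measurableSet
  -- Midpoints between the two cones lie in the ball of radius ρ < 1 (or ρ = 1 if ε = 0), so its
  -- indicator is admissible; the factor ρ^(2n) is the exponential gain.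
  have key : volume B' * volume C' ≤ volume D ^ 2 := by
    have := prekopaLeindler_euclideanSpace (f := B'.indicator 1) (g := C'.indicator 1)
      (h := D.indicator 1) (measurable_one.indicator hB') (measurable_one.indicator hC')
      (measurable_one.indicator hD) ?_
    · simpa [lintegral_indicator_one, hB', hC', hD] using this
    intro x y
    by_cases hx : x ∈ B'
    swap
    · simp [hx]
    by_cases hy : y ∈ C'
    swap
    · simp [hy]
    obtain ⟨r, hr, _, ⟨b, hb, rfl⟩, rfl⟩ := hx
    obtain ⟨s, hs, _, ⟨c, hc, rfl⟩, rfl⟩ := hy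
    have hm : (1 / 2 : ℝ) • (r • (b : EuclideanSpace ℝ (Fin n)) + s • (c : EuclideanSpace ℝ (Fin n))) ∈ D := by
      rw [mem_closedBall_zero_iff]
      refine norm_midpoint_smul_le (by simp) (by simp) hε ?_ ⟨hr.1.le, hr.2.le⟩ ⟨hs.1.le, hs.2.le⟩
      rw [← dist_eq_norm]
      exact hBC b hb c hc
    simp only [] at hm ⊢
    rw [indicator_of_mem hm]
    simp only [Pi.one_apply, one_pow]
    exact mul_le_one' (indicator_apply_le' (fun _ => le_rfl) (fun _ => zero_le_one))
      (indicator_apply_le' (fun _ => le_rfl) (fun _ => zero_le_one))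
  have hDvol : volume D = ENNReal.ofReal (ρ ^ n) *
      volume (Metric.ball (0 : EuclideanSpace ℝ (Fin n)) 1) := by
    rw [Measure.addHaar_closedBall _ _ (Real.exp_pos _).le, finrank_euclideanSpace,
      Fintype.card_fin]
  set V := volume (Metric.ball (0 : EuclideanSpace ℝ (Fin n)) 1)
  have hV0 : V ≠ 0 := (Metric.measure_ball_pos _ _ one_pos).ne'
  have hVt : V ≠ ∞ := measure_ball_lt_top.ne
  rw [unifSphere_apply hn hB.measurableSet, unifSphere_apply hn hC.measurableSet]
  calc volume B' / V * (volume C' / V) = volume B' * volume C' / (V * V) := by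
        rw [ENNReal.mul_div_mul_comm (Or.inl hV0) (Or.inl hVt)]
    _ ≤ volume D ^ 2 / (V * V) := by gcongr
    _ = ENNReal.ofReal (ρ ^ n) ^ 2 := by
        rw [hDvol, mul_pow, sq V, ENNReal.mul_div_cancel_right (by simp [hV0])
          (ENNReal.mul_ne_top hVt hVt)]
    _ = _ := by
        rw [← ENNReal.ofReal_pow (by positivity), ← pow_mul, ← Real.exp_nat_mul]
        congr 2
        push_cast
        ring

/-- The concentration of measure on the sphere, for arbitrary sets at distance `ε`. -/
theorem unifSphere_mul_le {n : ℕ} (hn : 0 < n)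
    {B C : Set (Metric.sphere (0 : EuclideanSpace ℝ (Fin n)) 1)} {ε : ℝ} (hε : 0 ≤ ε)
    (hBC : ∀ b ∈ B, ∀ c ∈ C, ε ≤ dist b c) :
    unifSphere n B * unifSphere n C ≤ ENNReal.ofReal (Real.exp (-(n * ε ^ 2 / 4))) := by
  refine (mul_le_mul' (measure_mono subset_closure) (measure_mono subset_closure)).trans
    (unifSphere_mul_le_of_isClosed hn isClosed_closure isClosed_closure hε ?_)
  have h1 : ∀ b ∈ B, ∀ c ∈ closure C, ε ≤ dist b c := fun b hb =>
    fun c hc => closure_minimal (hBC b hb)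
      (isClosed_le continuous_const (by fun_prop : Continuous fun c => dist b c)) hc
  exact fun b hb c hc => closure_minimal (fun b hb => h1 b hb c hc)
    (isClosed_le continuous_const (by fun_prop : Continuous fun b => dist b c)) hb

/-- The part of {f ≤ m} in G keeps measure at least 1/2 - 1/4 and has distance at least τ/κ from the
part of {f ≥ m + τ} in G. Dividing the product bound by 1/4 gives the factor 4. No measurability of
f or G is needed. -/
theorem unifSphere_ge_le {n : ℕ} (hn : 0 < n)
    {f : Metric.sphere (0 : EuclideanSpace ℝ (Fin n)) 1 → ℝ} {m τ κ : ℝ} (hκ : 0 < κ) (hτ : 0 ≤ τ)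
    {G : Set (Metric.sphere (0 : EuclideanSpace ℝ (Fin n)) 1)}
    (hG : unifSphere n Gᶜ ≤ 1 / 4) (hm : 1 / 2 ≤ unifSphere n {u | f u ≤ m})
    (hf : ∀ u ∈ G, ∀ v ∈ G, |f u - f v| ≤ κ * dist u v) :
    unifSphere n ({u | m + τ ≤ f u} ∩ G) ≤
      ENNReal.ofReal (4 * Real.exp (-(n * (τ / κ) ^ 2 / 4))) := by
  set B := {u | f u ≤ m} ∩ G
  set C := {u | m + τ ≤ f u} ∩ G
  have hB : 1 / 4 ≤ unifSphere n B := by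
    have h1 : unifSphere n {u | f u ≤ m} ≤ unifSphere n B + unifSphere n Gᶜ := by
      refine (measure_mono ?_).trans (measure_union_le _ _)
      intro u hu
      by_cases hg : u ∈ G
      · exact Or.inl ⟨hu, hg⟩
      · exact Or.inr hg
    have h2 : (1 / 4 : ℝ≥0∞) + 1 / 4 ≤ unifSphere n B + 1 / 4 := by
      calc (1 / 4 : ℝ≥0∞) + 1 / 4 = 1 / 2 := by
            rw [← ENNReal.toReal_eq_toReal_iff' (by simp) (by simp),
              ENNReal.toReal_add (by simp) (by simp)]
            norm_num
        _ ≤ unifSphere n {u | f u ≤ m} := hm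
        _ ≤ unifSphere n B + unifSphere n Gᶜ := h1
        _ ≤ _ := by gcongr
    exact (ENNReal.add_le_add_iff_right (by simp)).1 h2
  have hBC : ∀ b ∈ B, ∀ c ∈ C, τ / κ ≤ dist b c := by
    rintro b ⟨hb, hbG⟩ c ⟨hc, hcG⟩
    rw [div_le_iff₀ hκ, mul_comm]
    have h1 := hf b hbG c hcG
    have h2 : f b ≤ m := hb
    have h3 : m + τ ≤ f c := hc
    have h4 := neg_abs_le (f b - f c)
    linarith
  have key := unifSphere_mul_le hn (by positivity) hBC
  calc unifSphere n C = 4 * (1 / 4 * unifSphere n C) := by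
        rw [← mul_assoc, one_div, ENNReal.mul_inv_cancel (by simp) (by simp), one_mul]
    _ ≤ 4 * (unifSphere n B * unifSphere n C) := by gcongr
    _ ≤ 4 * ENNReal.ofReal (Real.exp (-(n * (τ / κ) ^ 2 / 4))) := by gcongr
    _ = _ := by rw [ENNReal.ofReal_mul (by norm_num)]; norm_num

/-- Lévy's lemma for a function that is Lipschitz on a large set `G`, with the median. -/
theorem unifSphere_abs_sub_median_ge_le {n : ℕ} (hn : 0 < n)
    {f : Metric.sphere (0 : EuclideanSpace ℝ (Fin n)) 1 → ℝ} {m τ κ : ℝ} (hκ : 0 < κ) (hτ : 0 ≤ τ)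
    {G : Set (Metric.sphere (0 : EuclideanSpace ℝ (Fin n)) 1)}
    (hG : unifSphere n Gᶜ ≤ 1 / 4) (hm : IsMedian (unifSphere n) f m)
    (hf : ∀ u ∈ G, ∀ v ∈ G, |f u - f v| ≤ κ * dist u v) :
    unifSphere n ({u | τ ≤ |f u - m|} ∩ G) ≤
      ENNReal.ofReal (8 * Real.exp (-(n * (τ / κ) ^ 2 / 4))) := by
  have h1 := unifSphere_ge_le hn hκ hτ hG hm.1 hf
  have h2 := unifSphere_ge_le hn (f := fun u => -f u) (m := -m) hκ hτ hG
    (by simpa using hm.2) (fun u hu v hv => by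
      rw [← abs_neg, show -(-f u - -f v) = f u - f v by ring]; exact hf u hu v hv)
  calc unifSphere n ({u | τ ≤ |f u - m|} ∩ G)
      ≤ unifSphere n ({u | m + τ ≤ f u} ∩ G) + unifSphere n ({u | -m + τ ≤ -f u} ∩ G) := by
        refine (measure_mono ?_).trans (measure_union_le _ _)
        rintro u ⟨hu, hg⟩
        rcases le_abs.1 (show τ ≤ |f u - m| from hu) with h | h
        · exact Or.inl ⟨by simp only [mem_ofPred_eq]; linarith, hg⟩
        · exact Or.inr ⟨by simp only [mem_ofPred_eq]; linarith, hg⟩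
    _ ≤ _ := add_le_add h1 h2
    _ = _ := by
        rw [← ENNReal.ofReal_add (by positivity) (by positivity)]
        congr 1
        ring

/-! ### Weyl's inequality and perturbation of Jacobi matrices. -/

theorem LinearMap.IsSymmetric.inner_apply_self_eq_sum {𝕜 E : Type*} [RCLike 𝕜]
    [NormedAddCommGroup E] [InnerProductSpace 𝕜 E] [FiniteDimensional 𝕜 E] {n : ℕ}
    {T : E →ₗ[𝕜] E} (hT : T.IsSymmetric) (hn : Module.finrank 𝕜 E = n) (x : E) :
    RCLike.re (inner 𝕜 (T x) x) =
      ∑ j, hT.eigenvalues hn j * ‖inner 𝕜 (hT.eigenvectorBasis hn j) x‖ ^ 2 := by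
  rw [← (hT.eigenvectorBasis hn).sum_inner_mul_inner (T x) x, map_sum]
  refine Finset.sum_congr rfl fun j _ => ?_
  rw [hT x, hT.apply_eigenvectorBasis, inner_smul_right, mul_assoc, RCLike.re_ofReal_mul]
  congr 1
  rw [← inner_conj_symm x, RCLike.conj_mul]
  norm_cast

/-- Weyl's monotonicity theorem: sorted eigenvalues are monotone in the quadratic form. -/
theorem LinearMap.IsSymmetric.eigenvalues_le_add {𝕜 E : Type*} [RCLike 𝕜]
    [NormedAddCommGroup E] [InnerProductSpace 𝕜 E] [FiniteDimensional 𝕜 E] {n : ℕ}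
    {T S : E →ₗ[𝕜] E} (hT : T.IsSymmetric) (hS : S.IsSymmetric)
    (hn : Module.finrank 𝕜 E = n) {c : ℝ}
    (h : ∀ x, RCLike.re (inner 𝕜 (T x) x) ≤ RCLike.re (inner 𝕜 (S x) x) + c * ‖x‖ ^ 2)
    (i : Fin n) : hT.eigenvalues hn i ≤ hS.eigenvalues hn i + c := by
  set b := hT.eigenvectorBasis hn
  set d := hS.eigenvectorBasis hn
  -- These are n - 1 functionals, so a nonzero x is orthogonal to the T-eigenvectors after i and the
  -- S-eigenvectors before i. At x the form of T is at least its i-th eigenvalue and that of S at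
  -- most its own, times ‖x‖².
  let L : E →ₗ[𝕜] ({j : Fin n // j ≠ i} → 𝕜) :=
    LinearMap.pi fun j => if i < j.1 then (innerSL 𝕜 (b j.1)).toLinearMap
      else (innerSL 𝕜 (d j.1)).toLinearMap
  obtain ⟨x, hxL, hx0⟩ := (Submodule.ne_bot_iff _).1
    (LinearMap.ker_ne_bot_of_finrank_lt (f := L) (by
      rw [Module.finrank_fintype_fun_eq_card, Fintype.card_subtype_compl, hn]
      simp [i.pos]))
  have hxL' : ∀ j : {j : Fin n // j ≠ i}, L x j = 0 := fun j => congrFun hxL j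
  have hb : ∀ j, i < j → inner 𝕜 (b j) x = 0 := by
    intro j hj
    have := hxL' ⟨j, hj.ne'⟩
    simpa [L, hj] using this
  have hd : ∀ j, j < i → inner 𝕜 (d j) x = 0 := by
    intro j hj
    have := hxL' ⟨j, hj.ne⟩
    simpa [L, hj.not_gt] using this
  have h1 : hT.eigenvalues hn i * ‖x‖ ^ 2 ≤ RCLike.re (inner 𝕜 (T x) x) := by
    rw [hT.inner_apply_self_eq_sum hn, ← b.sum_sq_norm_inner_right x, Finset.mul_sum]
    refine Finset.sum_le_sum fun j _ => ?_
    rcases le_or_gt j i with hj | hj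
    · gcongr
      exact hT.eigenvalues_antitone hn hj
    · simp [b, hb j hj]
  have h2 : RCLike.re (inner 𝕜 (S x) x) ≤ hS.eigenvalues hn i * ‖x‖ ^ 2 := by
    rw [hS.inner_apply_self_eq_sum hn, ← d.sum_sq_norm_inner_right x, Finset.mul_sum]
    refine Finset.sum_le_sum fun j _ => ?_
    rcases le_or_gt i j with hj | hj
    · gcongr
      exact hS.eigenvalues_antitone hn hj
    · simp [d, hd j hj]
  have hx : 0 < ‖x‖ ^ 2 := by positivity
  have := h x
  exact le_of_mul_le_mul_right (by linarith) hx

theorem sum_jacobiMatrix_abs_le {k : ℕ} {a b : ℕ → ℝ} {p q : ℝ} (hq : 0 ≤ q)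
    (ha : ∀ j < k, |a j| ≤ p) (hb : ∀ j, j + 1 < k → |b j| ≤ q) (i : Fin k) :
    ∑ j, |jacobiMatrix k a b i j| ≤ p + 2 * q := by
  have h1 : ∀ j, |jacobiMatrix k a b i j| ≤ (if i = j then p else 0) +
      (if i.1 + 1 = j.1 then q else 0) + (if j.1 + 1 = i.1 then q else 0) := by
    intro j
    simp only [jacobiMatrix, Matrix.of_apply, Fin.ext_iff]
    split_ifs <;> first | omega | skip
    · simpa using ha i.1 i.2
    · simpa using hb i.1 (by omega)
    · simpa using hb j.1 (by omega)
    · simp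
  have h2 : ∀ P : Fin k → Prop, [DecidablePred P] → (∀ j j', P j → P j' → j = j') →
      ∑ j, (if P j then q else 0) ≤ q := by
    intro P _ hP
    rw [← Finset.sum_filter, Finset.sum_const, nsmul_eq_mul]
    have : (Finset.univ.filter P).card ≤ 1 := Finset.card_le_one.2 fun j hj j' hj' =>
      hP j j' (Finset.mem_filter.1 hj).2 (Finset.mem_filter.1 hj').2
    calc ((Finset.univ.filter P).card : ℝ) * q ≤ 1 * q := by gcongr; exact_mod_cast this
      _ = q := one_mul q
  calc ∑ j, |jacobiMatrix k a b i j| ≤ _ := Finset.sum_le_sum fun j _ => h1 j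
    _ ≤ p + q + q := by
      rw [Finset.sum_add_distrib, Finset.sum_add_distrib]
      refine add_le_add (add_le_add (by simp) (h2 _ ?_)) (h2 _ ?_)
      · intro j j' h h'; exact Fin.ext (by omega)
      · intro j j' h h'; exact Fin.ext (by omega)
    _ = _ := by ring

/-- The difference of the two matrices is symmetric with absolute row sums at most p + 2q, hence by
the Schur test its quadratic form is at most (p + 2q)‖x‖²; Weyl's monotonicity concludes. -/
theorem jacobiEigenvalues_le_add {k : ℕ} {a b a' b' : ℕ → ℝ} {p q : ℝ} (hq : 0 ≤ q)
    (ha : ∀ j < k, |a j - a' j| ≤ p) (hb : ∀ j, j + 1 < k → |b j - b' j| ≤ q) (i : Fin k) :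
    jacobiEigenvalues k a b i ≤ jacobiEigenvalues k a' b' i + (p + 2 * q) := by
  refine LinearMap.IsSymmetric.eigenvalues_le_add _ _ finrank_euclideanSpace (fun x => ?_) _
  set D := jacobiMatrix k (fun j => a j - a' j) (fun j => b j - b' j)
  have hD : ∀ i j, jacobiMatrix k a b i j = jacobiMatrix k a' b' i j + D i j := by
    intro i j
    simp only [D, jacobiMatrix, Matrix.of_apply]
    split_ifs <;> ring
  have hDsymm : ∀ i j, D i j = D j i := fun i j => by
    have := congrFun (congrFun (jacobiMatrix_isHermitian k (fun j => a j - a' j)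
      (fun j => b j - b' j)) j) i
    simpa [Matrix.conjTranspose_apply] using this
  have hin : ∀ M : Matrix (Fin k) (Fin k) ℝ,
      RCLike.re (inner ℝ (Matrix.toEuclideanLin M x) x) = ∑ i, ∑ j, M i j * (x i * x j) := by
    intro M
    simp only [PiLp.inner_apply, Matrix.toLpLin_apply, Matrix.mulVec, dotProduct,
      RCLike.re_to_real]
    refine Finset.sum_congr rfl fun i _ => ?_
    simp only [RCLike.inner_apply, conj_trivial, Finset.mul_sum]
    refine Finset.sum_congr rfl fun j _ => by ring
  rw [hin, hin, EuclideanSpace.norm_sq_eq]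
  have hrow := sum_jacobiMatrix_abs_le (a := fun j => a j - a' j) (b := fun j => b j - b' j)
    hq ha hb
  have hsum : ∑ i, ∑ j, D i j * (x i * x j) ≤ ∑ i, ∑ j, |D i j| * x i ^ 2 := by
    have h1 : ∑ i, ∑ j, |D i j| * x i ^ 2 =
        ∑ i, ∑ j, |D i j| * ((x i ^ 2 + x j ^ 2) / 2) := by
      have h2 : ∑ i, ∑ j, |D i j| * x j ^ 2 = ∑ i, ∑ j, |D i j| * x i ^ 2 := by
        rw [Finset.sum_comm]
        simp_rw [hDsymm]
      have h3 : ∑ i, ∑ j, |D i j| * ((x i ^ 2 + x j ^ 2) / 2) =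
          (∑ i, ∑ j, |D i j| * x i ^ 2 + ∑ i, ∑ j, |D i j| * x j ^ 2) / 2 := by
        rw [← Finset.sum_add_distrib, Finset.sum_div]
        refine Finset.sum_congr rfl fun i _ => ?_
        rw [← Finset.sum_add_distrib, Finset.sum_div]
        refine Finset.sum_congr rfl fun j _ => by ring
      rw [h3, h2]; ring
    rw [h1]
    refine Finset.sum_le_sum fun i _ => Finset.sum_le_sum fun j _ => ?_
    calc D i j * (x i * x j) ≤ |D i j * (x i * x j)| := le_abs_self _
      _ = |D i j| * |x i * x j| := abs_mul _ _
      _ ≤ _ := by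
        gcongr
        exact abs_le.2 ⟨by nlinarith [sq_nonneg (x i + x j)], by nlinarith [sq_nonneg (x i - x j)]⟩
  calc ∑ i, ∑ j, jacobiMatrix k a b i j * (x i * x j)
      = ∑ i, ∑ j, jacobiMatrix k a' b' i j * (x i * x j) + ∑ i, ∑ j, D i j * (x i * x j) := by
        rw [← Finset.sum_add_distrib]
        refine Finset.sum_congr rfl fun i _ => ?_
        rw [← Finset.sum_add_distrib]
        refine Finset.sum_congr rfl fun j _ => by rw [hD]; ring
    _ ≤ _ := by
        gcongr
        refine hsum.trans ?_
        rw [Finset.mul_sum]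
        refine Finset.sum_le_sum fun i _ => ?_
        rw [← Finset.sum_mul, Real.norm_eq_abs, sq_abs]
        gcongr
        exact hrow i

theorem Finset.exists_lt_forall_le {ι : Type*} (s : Finset ι) (f : ι → ℝ) {c : ℝ}
    (h : ∀ i ∈ s, f i < c) : ∃ c' < c, ∀ i ∈ s, f i ≤ c' := by
  have h1 : ∀ᶠ c' in nhdsWithin c (Set.Iio c), ∀ i ∈ s, f i ≤ c' :=
    (s.eventually_all).2 fun i hi => by
      filter_upwards [Ioo_mem_nhdsLT (h i hi)] with c' hc' using hc'.1.le
  obtain ⟨c', h2, h3⟩ := (h1.and self_mem_nhdsWithin).exists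
  exact ⟨c', h3, h2⟩

/-- Finiteness leaves room below p and q, so strict bounds survive; this matches the non-strict
deviation events used later. The maxima with 0 keep the reduced bounds nonnegative, also when there
is no off-diagonal entry. -/
theorem norm_jacobiEigenvalues_sub_lt {k : ℕ} {a b a' b' : ℕ → ℝ} {p q : ℝ} (hp : 0 < p)
    (hq : 0 < q) (ha : ∀ j < k, |a j - a' j| < p) (hb : ∀ j, j + 1 < k → |b j - b' j| < q) :
    ‖jacobiEigenvalues k a b - jacobiEigenvalues k a' b'‖ < p + 2 * q := by
  obtain ⟨p', hp', hap⟩ := (Finset.range k).exists_lt_forall_le (fun j => |a j - a' j|)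
    (c := p) (by simpa using ha)
  obtain ⟨q', hq', hbq⟩ := (Finset.range (k - 1)).exists_lt_forall_le (fun j => |b j - b' j|)
    (c := q) (fun j hj => hb j (by have := Finset.mem_range.1 hj; omega))
  have ha1 : ∀ j < k, |a j - a' j| ≤ max p' 0 := fun j hj =>
    (hap j (Finset.mem_range.2 hj)).trans (le_max_left _ _)
  have hb1 : ∀ j, j + 1 < k → |b j - b' j| ≤ max q' 0 := fun j hj =>
    (hbq j (Finset.mem_range.2 (by omega))).trans (le_max_left _ _)
  have hp0 : max p' 0 < p := max_lt hp' hp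
  have hq0 : max q' 0 < q := max_lt hq' hq
  refine (pi_norm_lt_iff (by positivity)).2 fun i => ?_
  have h1 := jacobiEigenvalues_le_add (le_max_right q' 0) ha1 hb1 i
  have h2 := jacobiEigenvalues_le_add (p := max p' 0) (le_max_right q' 0)
    (fun j hj => by rw [abs_sub_comm]; exact ha1 j hj)
    (fun j hj => by rw [abs_sub_comm]; exact hb1 j hj) i
  rw [Pi.sub_apply, Real.norm_eq_abs, abs_lt]
  constructor <;> linarith

/-! ### Krylov spaces and the polynomials behind the Lanczos vectors. -/

open Polynomial in
/-- The Krylov space `{r(T) x : deg r < j}`. -/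
noncomputable def krylov {𝕜 E : Type*} [RCLike 𝕜] [NormedAddCommGroup E] [InnerProductSpace 𝕜 E]
    (T : E →L[𝕜] E) (x : E) (j : ℕ) : Submodule 𝕜 E :=
  (degreeLT 𝕜 j).map ((ContinuousLinearMap.apply 𝕜 E x).toLinearMap ∘ₗ (aeval T).toLinearMap)

section Krylov
open Polynomial

variable {𝕜 E : Type*} [RCLike 𝕜] [NormedAddCommGroup E] [InnerProductSpace 𝕜 E]
  {T : E →L[𝕜] E} {x : E}

theorem mem_krylov {j : ℕ} {y : E} :
    y ∈ krylov T x j ↔ ∃ r : 𝕜[X], r.degree < j ∧ aeval T r x = y := by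
  simp [krylov, mem_degreeLT]

theorem krylov_mono {i j : ℕ} (h : i ≤ j) : krylov T x i ≤ krylov T x j :=
  Submodule.map_mono (degreeLT_mono h)

theorem apply_mem_krylov {j : ℕ} {y : E} (hy : y ∈ krylov T x j) :
    T y ∈ krylov T x (j + 1) := by
  obtain ⟨r, hr, rfl⟩ := mem_krylov.1 hy
  refine mem_krylov.2 ⟨X * r, ?_, by simp⟩
  by_cases h0 : r = 0
  · simp [h0]
  · rw [degree_eq_natDegree h0] at hr
    have h1 : r.natDegree < j := by exact_mod_cast hr
    rw [mul_comm, degree_mul_X, degree_eq_natDegree h0]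
    exact_mod_cast Nat.add_lt_add_right h1 1

theorem self_mem_krylov : x ∈ krylov T x 1 :=
  mem_krylov.2 ⟨1, by simp, by simp⟩

theorem krylov_le {W : ℕ → Submodule 𝕜 E} (h0 : x ∈ W 0) (hW : Monotone W)
    (hT : ∀ j, ∀ y ∈ W j, T y ∈ W (j + 1)) (j : ℕ) : krylov T x (j + 1) ≤ W j := by
  intro y hy
  obtain ⟨r, hr, rfl⟩ := mem_krylov.1 hy
  have hpow : ∀ i, (T ^ i) x ∈ W i := by
    intro i
    induction i with
    | zero => simpa using h0
    | succ i ih =>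
      rw [pow_succ', mul_apply_eq_comp]
      exact hT i _ ih
  have hn : r.natDegree < j + 1 := by
    by_cases h0 : r = 0
    · simp [h0]
    · exact (natDegree_lt_iff_degree_lt h0).2 hr
  rw [aeval_eq_sum_range' hn, sum_apply]
  refine Submodule.sum_mem _ fun i hi => ?_
  exact Submodule.smul_mem _ _ (hW (by have := Finset.mem_range.1 hi; omega) (hpow i))

end Krylov

section Lanczos
open Polynomial

variable {𝕜 : Type*} [RCLike 𝕜] {n : ℕ} (A : Matrix (Fin n) (Fin n) 𝕜) (x : EuclideanSpace 𝕜 (Fin n))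

/-- The span of the first `j + 1` Lanczos vectors. -/
noncomputable def lanczosSpan (j : ℕ) : Submodule 𝕜 (EuclideanSpace 𝕜 (Fin n)) :=
  Submodule.span 𝕜 (Set.range fun i : Fin (j + 1) => lanczosVec A x i.1)

/-- The unnormalized Lanczos direction: the projection of `A v_j` onto the orthogonal complement
of the span of `v_0, …, v_j`. -/
noncomputable def lanczosDir (j : ℕ) : EuclideanSpace 𝕜 (Fin n) :=
  (lanczosSpan A x j)ᗮ.starProjection
    (Matrix.toEuclideanCLM (n := Fin n) (𝕜 := 𝕜) A (lanczosVec A x j))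

/-- The product `β_0 ⋯ β_{j-1}`. -/
noncomputable def lanczosProd (j : ℕ) : ℝ := ∏ i ∈ Finset.range j, ‖lanczosDir A x i‖

theorem lanczosVec_zero : lanczosVec A x 0 = x := by rw [lanczosVec]

theorem lanczosVec_succ (j : ℕ) :
    lanczosVec A x (j + 1) = ((‖lanczosDir A x j‖⁻¹ : ℝ) : 𝕜) • lanczosDir A x j := by
  rw [lanczosVec]; rfl

theorem norm_smul_lanczosVec_succ (j : ℕ) :
    ((‖lanczosDir A x j‖ : ℝ) : 𝕜) • lanczosVec A x (j + 1) = lanczosDir A x j := by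
  rw [lanczosVec_succ, smul_smul]
  by_cases h : lanczosDir A x j = 0
  · simp [h]
  · rw [← RCLike.ofReal_mul, mul_inv_cancel₀ (norm_ne_zero_iff.2 h), RCLike.ofReal_one, one_smul]

theorem norm_lanczosVec_succ {j : ℕ} (h : lanczosDir A x j ≠ 0) :
    ‖lanczosVec A x (j + 1)‖ = 1 := by
  rw [lanczosVec_succ, norm_smul, RCLike.norm_ofReal, abs_inv, abs_norm,
    inv_mul_cancel₀ (norm_ne_zero_iff.2 h)]

theorem norm_lanczosVec_le (hx : ‖x‖ = 1) (j : ℕ) : ‖lanczosVec A x j‖ ≤ 1 := by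
  cases j with
  | zero => rw [lanczosVec_zero, hx]
  | succ j =>
    by_cases h : lanczosDir A x j = 0
    · simp [lanczosVec_succ, h]
    · exact (norm_lanczosVec_succ A x h).le

theorem norm_lanczosDir_le (hx : ‖x‖ = 1) (j : ℕ) :
    ‖lanczosDir A x j‖ ≤ matrixSpectralNorm A := by
  refine (Submodule.norm_starProjection_apply_le _ _).trans
    ((ContinuousLinearMap.le_opNorm _ _).trans ?_)
  exact mul_le_of_le_one_right (norm_nonneg _) (norm_lanczosVec_le A x hx j)

theorem lanczosVec_mem_span {i j : ℕ} (h : i ≤ j) : lanczosVec A x i ∈ lanczosSpan A x j :=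
  Submodule.subset_span ⟨⟨i, by omega⟩, rfl⟩

theorem lanczosSpan_mono : Monotone (lanczosSpan A x) := by
  intro i j hij
  refine Submodule.span_le.2 ?_
  rintro _ ⟨l, rfl⟩
  exact lanczosVec_mem_span A x (by omega)

theorem apply_sub_lanczosDir_mem (j : ℕ) :
    Matrix.toEuclideanCLM (n := Fin n) (𝕜 := 𝕜) A (lanczosVec A x j) - lanczosDir A x j ∈
      lanczosSpan A x j := by
  have := Submodule.sub_starProjection_mem_orthogonal (K := (lanczosSpan A x j)ᗮ)
    (Matrix.toEuclideanCLM (n := Fin n) (𝕜 := 𝕜) A (lanczosVec A x j))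
  rwa [Submodule.orthogonal_orthogonal] at this

theorem apply_mem_lanczosSpan (j : ℕ) : ∀ y ∈ lanczosSpan A x j,
    Matrix.toEuclideanCLM (n := Fin n) (𝕜 := 𝕜) A y ∈ lanczosSpan A x (j + 1) := by
  intro y hy
  refine Submodule.span_induction ?_ (by simp) (fun y z _ _ hy hz => ?_) (fun c y _ hy => ?_) hy
  · rintro _ ⟨i, rfl⟩
    have h1 := lanczosSpan_mono A x (by omega : i.1 ≤ j + 1) (apply_sub_lanczosDir_mem A x i)
    have h2 : lanczosDir A x i ∈ lanczosSpan A x (j + 1) := by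
      rw [← norm_smul_lanczosVec_succ]
      exact Submodule.smul_mem _ _ (lanczosVec_mem_span A x (by omega))
    simpa using add_mem h1 h2
  · rw [map_add]; exact add_mem hy hz
  · rw [map_smul]; exact Submodule.smul_mem _ _ hy

/-- Each Lanczos step adds a multiple of A v_j minus a vector already in the span, and A maps each
span into the next. This remains true after a breakdown, where the new vectors are 0. -/
theorem lanczosSpan_eq_krylov (j : ℕ) : lanczosSpan A x j =
    krylov (Matrix.toEuclideanCLM (n := Fin n) (𝕜 := 𝕜) A) x (j + 1) := by
  apply le_antisymm
  · have hv : ∀ i, lanczosVec A x i ∈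
        krylov (Matrix.toEuclideanCLM (n := Fin n) (𝕜 := 𝕜) A) x (i + 1) := by
      intro i
      induction i using Nat.strong_induction_on with
      | _ i ih =>
        cases i with
        | zero => rw [lanczosVec_zero]; exact self_mem_krylov
        | succ i =>
          have h1 : lanczosSpan A x i ≤
              krylov (Matrix.toEuclideanCLM (n := Fin n) (𝕜 := 𝕜) A) x (i + 1 + 1) := by
            refine Submodule.span_le.2 ?_
            rintro _ ⟨l, rfl⟩
            exact krylov_mono (by omega) (ih l.1 (by omega))
          have h2 := apply_mem_krylov (ih i (by omega))
          rw [lanczosVec_succ]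
          refine Submodule.smul_mem _ _ ?_
          simpa using sub_mem h2 (h1 (apply_sub_lanczosDir_mem A x i))
    refine Submodule.span_le.2 ?_
    rintro _ ⟨l, rfl⟩
    exact krylov_mono (by omega) (hv l.1)
  · refine krylov_le ?_ (lanczosSpan_mono A x) (apply_mem_lanczosSpan A x) j
    simpa [lanczosVec_zero] using lanczosVec_mem_span A x (le_refl 0)

theorem exists_monic_aeval_eq_lanczosProd_smul (j : ℕ) : ∃ p : 𝕜[X], p.Monic ∧ p.natDegree = j ∧
    aeval (Matrix.toEuclideanCLM (n := Fin n) (𝕜 := 𝕜) A) p x =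
      (lanczosProd A x j : 𝕜) • lanczosVec A x j := by
  induction j with
  | zero => exact ⟨1, monic_one, by simp, by simp [lanczosProd, lanczosVec_zero]⟩
  | succ j ih =>
    obtain ⟨p, hp, hpj, hpx⟩ := ih
    have h1 := apply_sub_lanczosDir_mem A x j
    rw [lanczosSpan_eq_krylov] at h1
    obtain ⟨r, hr, hrx⟩ := mem_krylov.1 h1
    have hr' : ((lanczosProd A x j : 𝕜) • r).degree < (p * X).degree := by
      rw [degree_mul_X, degree_eq_natDegree hp.ne_zero, hpj]
      exact (degree_smul_le _ _).trans_lt hr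
    -- Here r(A)x is the part of A v_j removed by the projection. After a breakdown both sides
    -- vanish, so no case distinction is needed.
    refine ⟨p * X - (lanczosProd A x j : 𝕜) • r, (hp.mul monic_X).sub_of_left hr', ?_, ?_⟩
    · rw [natDegree_eq_of_degree_eq (degree_sub_eq_left_of_degree_lt hr'),
        natDegree_mul_X hp.ne_zero, hpj]
    · rw [map_sub, mul_comm, map_mul, map_smul, aeval_X, sub_apply,
        mul_apply_eq_comp, hpx, smul_apply, hrx, map_smul,
        ← smul_sub, sub_sub_cancel, lanczosProd, lanczosProd, Finset.prod_range_succ,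
        RCLike.ofReal_mul, mul_smul, norm_smul_lanczosVec_succ]

theorem inner_krylov_lanczosVec {j : ℕ} {y : EuclideanSpace 𝕜 (Fin n)}
    (hy : y ∈ krylov (Matrix.toEuclideanCLM (n := Fin n) (𝕜 := 𝕜) A) x j) :
    inner 𝕜 y (lanczosVec A x j) = 0 := by
  cases j with
  | zero =>
    obtain ⟨r, hr, rfl⟩ := mem_krylov.1 hy
    have : r = 0 := by simpa [Nat.WithBot.lt_zero_iff] using hr
    simp [this]
  | succ j =>
    rw [← lanczosSpan_eq_krylov] at hy
    rw [lanczosVec_succ, inner_smul_right]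
    have : lanczosDir A x j ∈ (lanczosSpan A x j)ᗮ := Submodule.starProjection_apply_mem _ _
    rw [(Submodule.mem_orthogonal _ _).1 this y hy, mul_zero]

theorem lanczosProd_nonneg (j : ℕ) : 0 ≤ lanczosProd A x j :=
  Finset.prod_nonneg fun _ _ => norm_nonneg _

theorem norm_lanczosProd_smul (hx : ‖x‖ = 1) (j : ℕ) :
    ‖(lanczosProd A x j : 𝕜) • lanczosVec A x j‖ = lanczosProd A x j := by
  rw [norm_smul, RCLike.norm_ofReal, abs_of_nonneg (lanczosProd_nonneg A x j)]
  cases j with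
  | zero => simp [lanczosProd, lanczosVec_zero, hx]
  | succ j =>
    by_cases h : lanczosDir A x j = 0
    · simp [lanczosProd, Finset.prod_range_succ, h]
    · rw [norm_lanczosVec_succ A x h, mul_one]

end Lanczos

/-! ### Monic polynomials with real roots in an interval. -/

section RealRoots
open Polynomial

/-- The monic polynomial `∏ l, (X - z l)` with the given real roots. -/
noncomputable def rootPoly (𝕜 : Type*) [RCLike 𝕜] {j : ℕ} (z : Fin j → ℝ) : 𝕜[X] :=
  ∏ l, (X - C ((z l : ℝ) : 𝕜))

variable {𝕜 : Type*} [RCLike 𝕜]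

theorem rootPoly_monic {j : ℕ} (z : Fin j → ℝ) : (rootPoly 𝕜 z).Monic :=
  monic_prod_of_monic _ _ fun _ _ => monic_X_sub_C _

theorem rootPoly_natDegree {j : ℕ} (z : Fin j → ℝ) : (rootPoly 𝕜 z).natDegree = j := by
  rw [rootPoly, natDegree_prod_of_monic _ _ fun _ _ => monic_X_sub_C _]
  simp

theorem norm_eval_rootPoly {j : ℕ} (z : Fin j → ℝ) (t : ℝ) :
    ‖(rootPoly 𝕜 z).eval (t : 𝕜)‖ = ∏ l, |t - z l| := by
  rw [rootPoly, eval_prod, norm_prod]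
  refine Finset.prod_congr rfl fun l _ => ?_
  rw [eval_sub, eval_X, eval_C, ← RCLike.ofReal_sub, RCLike.norm_ofReal]

theorem degree_sub_lt_of_monic {p q : 𝕜[X]} {j : ℕ} (hp : p.Monic) (hq : q.Monic)
    (hpj : p.natDegree = j) (hqj : q.natDegree = j) : (p - q).degree < j := by
  have := degree_sub_lt_left (p := p) (q := q)
    (by rw [degree_eq_natDegree hp.ne_zero, degree_eq_natDegree hq.ne_zero, hpj, hqj])
    hp.ne_zero (by rw [hp, hq])
  rwa [degree_eq_natDegree hp.ne_zero, hpj] at this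

theorem abs_sub_max_min_le {R t z : ℝ} (ht : |t| ≤ R) : |t - max (-R) (min R z)| ≤ |t - z| := by
  obtain ⟨h1, h2⟩ := abs_le.1 ht
  rcases le_total R z with h | h
  · rw [min_eq_left h, max_eq_right (by linarith), abs_sub_comm, abs_sub_comm t,
      abs_of_nonneg (by linarith), abs_of_nonneg (by linarith)]
    linarith
  · rw [min_eq_right h]
    rcases le_total (-R) z with h' | h'
    · rw [max_eq_right h']
    · rw [max_eq_left h', abs_of_nonneg (by linarith), abs_of_nonneg (by linarith)]
      linarith

/-- Any monic polynomial is dominated on `[-R, R]` by a monic polynomial of the same degree with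
all its roots in `[-R, R]`. -/
theorem exists_rootPoly_eval_le {p : 𝕜[X]} {j : ℕ} (hp : p.Monic) (hpj : p.natDegree = j) {R : ℝ}
    (hR : 0 ≤ R) : ∃ z : Fin j → ℝ, (∀ l, |z l| ≤ R) ∧
      ∀ t : ℝ, |t| ≤ R → ∏ l, |t - z l| ≤ ‖p.eval (t : 𝕜)‖ := by
  -- At real points, taking real parts of the coefficients takes the real part of the value, so it
  -- cannot increase the modulus.
  set q : ℝ[X] := ∑ i ∈ Finset.range (j + 1), C (RCLike.re (p.coeff i)) * X ^ i
  have hqc : ∀ i, q.coeff i = RCLike.re (p.coeff i) := by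
    intro i
    simp only [q, finsetSum_coeff, coeff_C_mul, coeff_X_pow, mul_ite, mul_one, mul_zero]
    rw [Finset.sum_ite_eq]
    split_ifs with h
    · rfl
    · rw [coeff_eq_zero_of_natDegree_lt (by simp at h; omega), map_zero]
  have hqd : q.natDegree ≤ j := natDegree_le_iff_coeff_eq_zero.2 fun i hi => by
    rw [hqc, coeff_eq_zero_of_natDegree_lt (by omega), map_zero]
  have hqm : q.Monic := monic_of_natDegree_le_of_coeff_eq_one j hqd (by
    rw [hqc, ← hpj, coeff_natDegree, hp]; simp)
  have hqj : q.natDegree = j := le_antisymm hqd (le_natDegree_of_ne_zero (by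
    rw [hqc, ← hpj, coeff_natDegree, hp]; simp))
  have hqe : ∀ t : ℝ, |q.eval t| ≤ ‖p.eval (t : 𝕜)‖ := by
    intro t
    have : q.eval t = RCLike.re (p.eval (t : 𝕜)) := by
      rw [eval_eq_sum_range, eval_eq_sum_range, map_sum, hqj, hpj]
      refine Finset.sum_congr rfl fun i _ => ?_
      rw [hqc, ← RCLike.ofReal_pow, RCLike.re_mul_ofReal]
    rw [this]
    exact RCLike.abs_re_le_norm _
  set M := (q.map (algebraMap ℝ ℂ)).roots
  have hsplit : (q.map (algebraMap ℝ ℂ)).Splits := IsAlgClosed.splits _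
  have hcard : Multiset.card M = j := by
    rw [← hsplit.natDegree_eq_card_roots, hqm.natDegree_map, hqj]
  obtain ⟨L, hL⟩ := Quot.exists_rep M
  have hLM : (L : Multiset ℂ) = M := hL
  have hlen : L.length = j := by rw [← hcard, ← hLM, Multiset.coe_card]
  subst hlen
  -- Replacing a complex root by its real part, and then clamping to [-R, R], brings it closer to
  -- every point of [-R, R].
  refine ⟨fun l => max (-R) (min R (L.get l).re), fun l => ?_, fun t ht => ?_⟩
  · rw [abs_le]
    exact ⟨le_max_left _ _, max_le (by linarith) (min_le_left _ _)⟩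
  · refine le_trans ?_ (hqe t)
    have h1 : |q.eval t| = ∏ l, ‖(t : ℂ) - L.get l‖ := by
      have h2 : (q.map (algebraMap ℝ ℂ)).eval (t : ℂ) = ((q.eval t : ℝ) : ℂ) := by
        rw [eval_map, ← Complex.coe_algebraMap, eval₂_at_apply]
      have h3 : (q.map (algebraMap ℝ ℂ)).eval (t : ℂ) = ∏ l, ((t : ℂ) - L.get l) := by
        rw [hsplit.eq_prod_roots_of_monic (hqm.map _)]
        change eval _ (M.map fun a => X - C a).prod = _
        rw [← hLM, Multiset.map_coe,
          Multiset.prod_coe, eval_list_prod, List.map_map, ← List.prod_ofFn]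
        congr 1
        conv_lhs => rw [← List.ofFn_get L]
        rw [List.map_ofFn]
        congr 1
        ext l
        simp
      rw [← Real.norm_eq_abs, ← Complex.norm_real, ← h2, h3, norm_prod]
    rw [h1]
    refine Finset.prod_le_prod (fun _ _ => abs_nonneg _) fun l _ => ?_
    refine (abs_sub_max_min_le ht).trans ?_
    refine le_trans ?_ (Complex.abs_re_le_norm _)
    simp

end RealRoots

/-! ### Functional calculus of A in its eigenbasis. -/

section Spectral
open Polynomial

variable {𝕜 : Type*} [RCLike 𝕜] {n : ℕ} {A : Matrix (Fin n) (Fin n) 𝕜}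

theorem Matrix.IsHermitian.toEuclideanCLM_eigenvectorBasis (hA : A.IsHermitian) (i : Fin n) :
    Matrix.toEuclideanCLM (n := Fin n) (𝕜 := 𝕜) A (hA.eigenvectorBasis i) =
      (hA.eigenvalues i : 𝕜) • hA.eigenvectorBasis i := by
  ext l
  have := congrFun (hA.mulVec_eigenvectorBasis i) l
  simpa [RCLike.real_smul_eq_coe_mul] using this

theorem Matrix.IsHermitian.abs_eigenvalues_le (hA : A.IsHermitian) (i : Fin n) :
    |hA.eigenvalues i| ≤ matrixSpectralNorm A := by
  have h1 := (Matrix.toEuclideanCLM (n := Fin n) (𝕜 := 𝕜) A).le_opNorm (hA.eigenvectorBasis i)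
  rw [hA.toEuclideanCLM_eigenvectorBasis, norm_smul, RCLike.norm_ofReal,
    hA.eigenvectorBasis.norm_eq_one, mul_one, mul_one] at h1
  exact h1

theorem Matrix.IsHermitian.inner_toEuclideanCLM_left (hA : A.IsHermitian)
    (x y : EuclideanSpace 𝕜 (Fin n)) :
    inner 𝕜 (Matrix.toEuclideanCLM (n := Fin n) (𝕜 := 𝕜) A x) y =
      inner 𝕜 x (Matrix.toEuclideanCLM (n := Fin n) (𝕜 := 𝕜) A y) :=
  Matrix.isSymmetric_toEuclideanLin_iff.mpr hA x y

theorem Matrix.IsHermitian.inner_eigenvectorBasis_aeval (hA : A.IsHermitian) (p : 𝕜[X])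
    (x : EuclideanSpace 𝕜 (Fin n)) (i : Fin n) :
    inner 𝕜 (hA.eigenvectorBasis i)
        (aeval (Matrix.toEuclideanCLM (n := Fin n) (𝕜 := 𝕜) A) p x) =
      p.eval (hA.eigenvalues i : 𝕜) * inner 𝕜 (hA.eigenvectorBasis i) x := by
  induction p using Polynomial.induction_on' with
  | add p q hp hq => rw [map_add, _root_.add_apply, inner_add_right, hp, hq, eval_add, add_mul]
  | monomial m c =>
    rw [← C_mul_X_pow_eq_monomial]
    induction m generalizing c with
    | zero =>
      simp only [pow_zero, mul_one, aeval_C, eval_C]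
      rw [Algebra.algebraMap_eq_smul_one, _root_.smul_apply, inner_smul_right]
      simp
    | succ m ih =>
      have h1 : (C c * X ^ (m + 1) : 𝕜[X]) = X * (C c * X ^ m) := by ring
      rw [h1, map_mul, aeval_X, mul_apply_eq_comp, ← hA.inner_toEuclideanCLM_left,
        hA.toEuclideanCLM_eigenvectorBasis, inner_smul_left, ih, eval_mul (p := X),
        eval_X, RCLike.conj_ofReal, mul_assoc]

theorem Matrix.IsHermitian.norm_sq_aeval (hA : A.IsHermitian) (p : 𝕜[X])
    (x : EuclideanSpace 𝕜 (Fin n)) :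
    ‖aeval (Matrix.toEuclideanCLM (n := Fin n) (𝕜 := 𝕜) A) p x‖ ^ 2 =
      ∑ i, ‖p.eval (hA.eigenvalues i : 𝕜)‖ ^ 2 * ‖inner 𝕜 (hA.eigenvectorBasis i) x‖ ^ 2 := by
  rw [← hA.eigenvectorBasis.sum_sq_norm_inner_right]
  refine Finset.sum_congr rfl fun i _ => ?_
  rw [hA.inner_eigenvectorBasis_aeval, norm_mul, mul_pow]

/-- The Lanczos vector, scaled by `β_0 ⋯ β_{j-1}`, is `q(A) x` for a monic polynomial `q` with
all its roots in `[-‖A‖, ‖A‖]`. -/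
theorem exists_rootPoly_aeval_eq_lanczosProd_smul (hA : A.IsHermitian)
    (x : EuclideanSpace 𝕜 (Fin n)) (j : ℕ) :
    ∃ z : Fin j → ℝ, (∀ l, |z l| ≤ matrixSpectralNorm A) ∧
      aeval (Matrix.toEuclideanCLM (n := Fin n) (𝕜 := 𝕜) A) (rootPoly 𝕜 z) x =
        (lanczosProd A x j : 𝕜) • lanczosVec A x j := by
  obtain ⟨p, hp, hpj, hpx⟩ := exists_monic_aeval_eq_lanczosProd_smul A x j
  obtain ⟨z, hz, hzp⟩ := exists_rootPoly_eval_le hp hpj (norm_nonneg _ : 0 ≤ matrixSpectralNorm A)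
  refine ⟨z, hz, ?_⟩
  set T := Matrix.toEuclideanCLM (n := Fin n) (𝕜 := 𝕜) A
  set w := (lanczosProd A x j : 𝕜) • lanczosVec A x j
  -- The real-rooted polynomial is no larger at any eigenvalue. It differs from p by lower degree,
  -- so its value at x is w plus a vector orthogonal to w; Pythagoras forces that vector to be 0.
  have hle : ‖aeval T (rootPoly 𝕜 z) x‖ ^ 2 ≤ ‖w‖ ^ 2 := by
    rw [← hpx, hA.norm_sq_aeval, hA.norm_sq_aeval]
    refine Finset.sum_le_sum fun i _ => ?_
    gcongr
    rw [norm_eval_rootPoly]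
    exact hzp _ (hA.abs_eigenvalues_le i)
  set y := aeval T (rootPoly 𝕜 z - p) x
  have hy : inner 𝕜 y w = 0 := by
    rw [inner_smul_right, inner_krylov_lanczosVec A x (mem_krylov.2 ⟨_, degree_sub_lt_of_monic
      (rootPoly_monic z) hp (rootPoly_natDegree z) hpj, rfl⟩), mul_zero]
  have hsum : aeval T (rootPoly 𝕜 z) x = y + w := by
    simp only [y]
    rw [map_sub, sub_apply, hpx, sub_add_cancel]
  have hpyth := norm_add_sq_eq_norm_sq_add_norm_sq_of_inner_eq_zero y w hy
  rw [hsum] at hle ⊢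
  have : ‖y‖ = 0 := by nlinarith [norm_nonneg y]
  rw [norm_eq_zero.1 this, zero_add]

end Spectral

/-! ### Lipschitz dependence of the Jacobi coefficients on the starting vector. -/

/-- With c = Re⟨v, v'⟩ ≤ 1, the difference of the squares is (s - t)² + 2t(s - t)(1 - c). -/
theorem mul_norm_sub_le_norm_smul_sub_smul {𝕜 E : Type*} [RCLike 𝕜] [NormedAddCommGroup E]
    [InnerProductSpace 𝕜 E] {v v' : E} {s t : ℝ} (ht : 0 < t) (hts : t ≤ s)
    (hv : ‖v‖ = 1) (hv' : ‖v'‖ = 1) : t * ‖v - v'‖ ≤ ‖(s : 𝕜) • v - (t : 𝕜) • v'‖ := by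
  refine (sq_le_sq₀ (by positivity) (norm_nonneg _)).1 ?_
  rw [mul_pow, norm_sub_sq (𝕜 := 𝕜), norm_sub_sq (𝕜 := 𝕜), norm_smul, norm_smul, inner_smul_left,
    inner_smul_right, hv, hv', RCLike.norm_ofReal, RCLike.norm_ofReal, RCLike.conj_ofReal,
    RCLike.re_ofReal_mul, RCLike.re_ofReal_mul, abs_of_pos ht, abs_of_pos (ht.trans_le hts)]
  have h1 : RCLike.re (inner 𝕜 v v') ≤ 1 := by
    have := re_inner_le_norm (𝕜 := 𝕜) v v'
    rwa [hv, hv', one_mul] at this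
  nlinarith [sq_nonneg (s - t), mul_nonneg (mul_nonneg ht.le (sub_nonneg.2 hts)) (sub_nonneg.2 h1)]

theorem abs_re_inner_apply_sub_le {𝕜 E : Type*} [RCLike 𝕜] [NormedAddCommGroup E]
    [InnerProductSpace 𝕜 E] (T : E →L[𝕜] E) {v v' : E} (hv : ‖v‖ ≤ 1) (hv' : ‖v'‖ ≤ 1) :
    |RCLike.re (inner 𝕜 (T v) v) - RCLike.re (inner 𝕜 (T v') v')| ≤ 2 * ‖T‖ * ‖v - v'‖ := by
  have h : inner 𝕜 (T v) v - inner 𝕜 (T v') v' =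
      inner 𝕜 (T (v - v')) v + inner 𝕜 (T v') (v - v') := by
    rw [map_sub, inner_sub_left, inner_sub_right]; ring
  rw [← map_sub, h]
  have h1 : ‖inner 𝕜 (T (v - v')) v‖ ≤ ‖T‖ * ‖v - v'‖ * 1 :=
    (norm_inner_le_norm _ _).trans (mul_le_mul (T.le_opNorm _) hv (norm_nonneg _) (by positivity))
  have h2 : ‖inner 𝕜 (T v') (v - v')‖ ≤ ‖T‖ * 1 * ‖v - v'‖ :=
    (norm_inner_le_norm _ _).trans (mul_le_mul_of_nonneg_right
      ((T.le_opNorm _).trans (mul_le_mul_of_nonneg_left hv' (norm_nonneg _))) (norm_nonneg _))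
  calc _ ≤ ‖inner 𝕜 (T (v - v')) v + inner 𝕜 (T v') (v - v')‖ := RCLike.abs_re_le_norm _
    _ ≤ _ := norm_add_le _ _
    _ ≤ 2 * ‖T‖ * ‖v - v'‖ := by linarith

theorem sum_range_pow_le {Y : ℝ} (hY : 2 ≤ Y) (j : ℕ) : ∑ i ∈ Finset.range j, Y ^ i ≤ Y ^ j := by
  induction j with
  | zero => simp
  | succ j ih =>
    rw [Finset.sum_range_succ, pow_succ]
    nlinarith [pow_nonneg (by linarith : (0 : ℝ) ≤ Y) j]

section Lipschitz
open Polynomial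

variable {𝕜 : Type*} [RCLike 𝕜] {n : ℕ} {A : Matrix (Fin n) (Fin n) 𝕜}
  {x y : EuclideanSpace 𝕜 (Fin n)}

theorem matrixSpectralNorm_nonneg (A : Matrix (Fin n) (Fin n) 𝕜) : 0 ≤ matrixSpectralNorm A :=
  norm_nonneg _

theorem norm_aeval_rootPoly_le {E : Type*} [NormedAddCommGroup E] [InnerProductSpace 𝕜 E]
    (T : E →L[𝕜] E) {j : ℕ} {z : Fin j → ℝ} (hz : ∀ l, |z l| ≤ ‖T‖) (h : E) :
    ‖aeval T (rootPoly 𝕜 z) h‖ ≤ (2 * ‖T‖) ^ j * ‖h‖ := by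
  have key : ∀ s : Finset (Fin j), ‖aeval T (∏ l ∈ s, (X - C ((z l : ℝ) : 𝕜))) h‖ ≤
      (2 * ‖T‖) ^ s.card * ‖h‖ := by
    intro s
    induction s using Finset.induction_on with
    | empty => simp
    | insert a s ha ih =>
      rw [Finset.prod_insert ha, Finset.card_insert_of_notMem ha, map_mul, mul_apply_eq_comp]
      set g := aeval T (∏ l ∈ s, (X - C ((z l : ℝ) : 𝕜))) h
      have h1 : aeval T (X - C ((z a : ℝ) : 𝕜)) g = T g - ((z a : ℝ) : 𝕜) • g := by
        rw [map_sub, sub_apply, aeval_X, aeval_C, Algebra.algebraMap_eq_smul_one, smul_apply]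
        simp
      rw [h1]
      calc ‖T g - ((z a : ℝ) : 𝕜) • g‖ ≤ ‖T g‖ + ‖((z a : ℝ) : 𝕜) • g‖ := norm_sub_le _ _
        _ ≤ ‖T‖ * ‖g‖ + ‖T‖ * ‖g‖ := by
          refine add_le_add (T.le_opNorm g) ?_
          rw [norm_smul, RCLike.norm_ofReal]
          exact mul_le_mul_of_nonneg_right (hz a) (norm_nonneg _)
        _ = 2 * ‖T‖ * ‖g‖ := by ring
        _ ≤ 2 * ‖T‖ * ((2 * ‖T‖) ^ s.card * ‖h‖) := by gcongr
        _ = _ := by ring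
  simpa [rootPoly] using key Finset.univ

theorem inner_aeval_lanczosProd_smul {j : ℕ} {r : 𝕜[X]} (hr : r.degree < j) :
    inner 𝕜 (aeval (Matrix.toEuclideanCLM (n := Fin n) (𝕜 := 𝕜) A) r x)
      ((lanczosProd A x j : 𝕜) • lanczosVec A x j) = 0 := by
  rw [inner_smul_right, inner_krylov_lanczosVec A x (mem_krylov.2 ⟨r, hr, rfl⟩), mul_zero]

/-- The product `β_0 ⋯ β_{j-1}` is the minimum of `‖p(A) x‖` over monic `p` of degree `j`. -/
theorem lanczosProd_le_norm_aeval (hA : A.IsHermitian) (hx : ‖x‖ = 1) {j : ℕ} {p : 𝕜[X]}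
    (hp : p.Monic) (hpj : p.natDegree = j) :
    lanczosProd A x j ≤ ‖aeval (Matrix.toEuclideanCLM (n := Fin n) (𝕜 := 𝕜) A) p x‖ := by
  obtain ⟨z, -, hzx⟩ := exists_rootPoly_aeval_eq_lanczosProd_smul hA x j
  have h0 := inner_aeval_lanczosProd_smul (A := A) (x := x)
    (degree_sub_lt_of_monic hp (rootPoly_monic z) hpj (rootPoly_natDegree z))
  have hpyth := norm_add_sq_eq_norm_sq_add_norm_sq_of_inner_eq_zero _ _ h0
  rw [norm_lanczosProd_smul A x hx, ← hzx, map_sub, sub_apply, sub_add_cancel] at hpyth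
  refine (sq_le_sq₀ (lanczosProd_nonneg A x j) (norm_nonneg _)).1 ?_
  nlinarith [sq_nonneg ‖aeval (Matrix.toEuclideanCLM (n := Fin n) (𝕜 := 𝕜) A) p x -
    aeval (Matrix.toEuclideanCLM (n := Fin n) (𝕜 := 𝕜) A) (rootPoly 𝕜 z) x‖]

/-- The optimal polynomial for y is a competitor for x, and its norm as an operator is at most
(2‖A‖)^j. -/
theorem lanczosProd_le_add (hA : A.IsHermitian) (hx : ‖x‖ = 1) (hy : ‖y‖ = 1) (j : ℕ) :
    lanczosProd A x j ≤ lanczosProd A y j + (2 * matrixSpectralNorm A) ^ j * ‖x - y‖ := by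
  obtain ⟨z, hz, hzy⟩ := exists_rootPoly_aeval_eq_lanczosProd_smul hA y j
  have h1 := lanczosProd_le_norm_aeval hA hx (rootPoly_monic z) (rootPoly_natDegree z)
  refine h1.trans ?_
  rw [show x = y + (x - y) by abel, map_add, hzy]
  refine (norm_add_le _ _).trans ?_
  rw [norm_lanczosProd_smul A y hy, ← show x = y + (x - y) by abel]
  gcongr
  exact norm_aeval_rootPoly_le _ hz _

theorem abs_lanczosProd_sub_le (hA : A.IsHermitian) (hx : ‖x‖ = 1) (hy : ‖y‖ = 1) (j : ℕ) :
    |lanczosProd A x j - lanczosProd A y j| ≤ (2 * matrixSpectralNorm A) ^ j * ‖x - y‖ := by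
  have h1 := lanczosProd_le_add hA hx hy j
  have h2 := lanczosProd_le_add hA hy hx j
  rw [norm_sub_rev] at h2
  rw [abs_le]; constructor <;> linarith

/-- On polynomials of degree `< j`, the norm `‖r(A)‖` is controlled by `‖r(A) x‖`. -/
theorem norm_aeval_apply_le (hA : A.IsHermitian) (hx : ‖x‖ = 1) (h : EuclideanSpace 𝕜 (Fin n))
    {j : ℕ} (hD : ∀ i < j, 0 < lanczosProd A x i) {r : 𝕜[X]} (hr : r.degree < j) :
    ‖aeval (Matrix.toEuclideanCLM (n := Fin n) (𝕜 := 𝕜) A) r h‖ ≤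
      ‖aeval (Matrix.toEuclideanCLM (n := Fin n) (𝕜 := 𝕜) A) r x‖ *
        (∑ i ∈ Finset.range j, (2 * matrixSpectralNorm A) ^ i / lanczosProd A x i) * ‖h‖ := by
  induction j generalizing r with
  | zero =>
    have : r = 0 := by simpa [Nat.WithBot.lt_zero_iff] using hr
    simp [this]
  | succ j ih =>
    obtain ⟨z, hz, hzx⟩ := exists_rootPoly_aeval_eq_lanczosProd_smul hA x j
    set T := Matrix.toEuclideanCLM (n := Fin n) (𝕜 := 𝕜) A
    set q := rootPoly 𝕜 z
    set c := r.coeff j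
    -- Subtracting the leading multiple of the j-th orthogonal polynomial lowers the degree. The two
    -- parts are orthogonal at x, so ‖c‖ D_j ≤ ‖r(A)x‖, while q(A) has norm at most (2‖A‖)^j.
    set r' := r - C c * q
    have hq1 : q.coeff j = 1 := by
      have := rootPoly_monic (𝕜 := 𝕜) z
      rwa [Monic, leadingCoeff, rootPoly_natDegree] at this
    have hr' : r'.degree < j := by
      rw [degree_lt_iff_coeff_zero]
      intro i hi
      rw [coeff_sub, coeff_C_mul]
      rcases hi.eq_or_lt with rfl | hi
      · simp [c, hq1]
      · rw [(degree_lt_iff_coeff_zero _ _).1 hr i hi,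
          coeff_eq_zero_of_natDegree_lt (by rw [rootPoly_natDegree]; exact hi)]
        simp
    have hrsum : ∀ g, aeval T r g = aeval T r' g + c • aeval T q g := by
      intro g
      simp only [r']
      rw [map_sub, sub_apply, map_mul, aeval_C, mul_apply_eq_comp, Algebra.algebraMap_eq_smul_one,
        smul_apply]
      simp
    have hDj := hD j (Nat.lt_succ_self j)
    have hpyth : ‖aeval T r x‖ ^ 2 =
        ‖aeval T r' x‖ ^ 2 + (‖c‖ * lanczosProd A x j) ^ 2 := by
      rw [hrsum, ← norm_lanczosProd_smul A x hx, ← norm_smul, hzx, sq, sq, sq]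
      refine norm_add_sq_eq_norm_sq_add_norm_sq_of_inner_eq_zero (𝕜 := 𝕜) _ _ ?_
      rw [inner_smul_right, inner_aeval_lanczosProd_smul hr', mul_zero]
    have h1 : ‖aeval T r' x‖ ≤ ‖aeval T r x‖ :=
      (sq_le_sq₀ (norm_nonneg _) (norm_nonneg _)).1 (by nlinarith [sq_nonneg (‖c‖ * lanczosProd A x j)])
    have h2 : ‖c‖ * lanczosProd A x j ≤ ‖aeval T r x‖ :=
      (sq_le_sq₀ (by positivity) (norm_nonneg _)).1 (by nlinarith [sq_nonneg ‖aeval T r' x‖])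
    have h3 : ‖c‖ ≤ ‖aeval T r x‖ / lanczosProd A x j := (le_div_iff₀ hDj).2 h2
    have h4 := ih (fun i hi => hD i (by omega)) hr'
    have h5 : 0 ≤ ∑ i ∈ Finset.range j, (2 * matrixSpectralNorm A) ^ i / lanczosProd A x i :=
      Finset.sum_nonneg fun i hi => div_nonneg
        (pow_nonneg (mul_nonneg zero_le_two (matrixSpectralNorm_nonneg A)) _)
        (lanczosProd_nonneg A x i)
    have hK : 0 ≤ (2 * matrixSpectralNorm A) ^ j :=
      pow_nonneg (mul_nonneg zero_le_two (matrixSpectralNorm_nonneg A)) _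
    calc ‖aeval T r h‖ ≤ ‖aeval T r' h‖ + ‖c‖ * ‖aeval T q h‖ := by
          rw [hrsum, ← norm_smul]; exact norm_add_le _ _
      _ ≤ ‖aeval T r x‖ * (∑ i ∈ Finset.range j,
            (2 * matrixSpectralNorm A) ^ i / lanczosProd A x i) * ‖h‖ +
          ‖aeval T r x‖ / lanczosProd A x j * ((2 * matrixSpectralNorm A) ^ j * ‖h‖) := by
          refine add_le_add (h4.trans (by gcongr)) ?_
          exact mul_le_mul h3 (norm_aeval_rootPoly_le T hz h) (norm_nonneg _) (by positivity)
      _ = _ := by rw [Finset.sum_range_succ]; ring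

/-- Let r be the optimal polynomial of y minus that of x. Orthogonality at x and at y shows that
‖r(A)x‖² is of first order in x - y times ‖r(A)x‖; one factor cancels. -/
theorem norm_lanczosProd_smul_sub_le (hA : A.IsHermitian) (hx : ‖x‖ = 1) (hy : ‖y‖ = 1) {j : ℕ}
    (hD : ∀ i < j, 0 < lanczosProd A x i) :
    ‖(lanczosProd A x j : 𝕜) • lanczosVec A x j - (lanczosProd A y j : 𝕜) • lanczosVec A y j‖ ≤
      (lanczosProd A y j *
        (∑ i ∈ Finset.range j, (2 * matrixSpectralNorm A) ^ i / lanczosProd A x i) +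
          2 * (2 * matrixSpectralNorm A) ^ j) * ‖x - y‖ := by
  obtain ⟨z, hz, hzx⟩ := exists_rootPoly_aeval_eq_lanczosProd_smul hA x j
  obtain ⟨z', hz', hzy⟩ := exists_rootPoly_aeval_eq_lanczosProd_smul hA y j
  set T := Matrix.toEuclideanCLM (n := Fin n) (𝕜 := 𝕜) A
  set S := ∑ i ∈ Finset.range j, (2 * matrixSpectralNorm A) ^ i / lanczosProd A x i
  set K := (2 * matrixSpectralNorm A) ^ j
  set r := rootPoly 𝕜 z' - rootPoly 𝕜 z
  have hr : r.degree < j := degree_sub_lt_of_monic (rootPoly_monic z') (rootPoly_monic z)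
    (rootPoly_natDegree z') (rootPoly_natDegree z)
  have hq : ‖aeval T (rootPoly 𝕜 z') (x - y)‖ ≤ K * ‖x - y‖ := norm_aeval_rootPoly_le T hz' _
  have hrx : aeval T r x = aeval T (rootPoly 𝕜 z') x - aeval T (rootPoly 𝕜 z) x := by
    simp only [r]; rw [map_sub, sub_apply]
  clear_value r
  have h1 : inner 𝕜 (aeval T r x) (aeval T r x) =
      inner 𝕜 (aeval T r (x - y)) (aeval T (rootPoly 𝕜 z') y) +
        inner 𝕜 (aeval T r x) (aeval T (rootPoly 𝕜 z') (x - y)) := by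
    have e1 : inner 𝕜 (aeval T r x) (aeval T (rootPoly 𝕜 z) x) = 0 := by
      rw [hzx]; exact inner_aeval_lanczosProd_smul hr
    have e2 : inner 𝕜 (aeval T r y) (aeval T (rootPoly 𝕜 z') y) = 0 := by
      rw [hzy]; exact inner_aeval_lanczosProd_smul hr
    conv_lhs => rw [hrx, inner_sub_right, ← hrx, e1]
    rw [map_sub, map_sub, inner_sub_left, inner_sub_right, e2]
    ring
  have h2 : ‖aeval T r x‖ ^ 2 ≤
      ‖aeval T r x‖ * S * ‖x - y‖ * lanczosProd A y j + ‖aeval T r x‖ * (K * ‖x - y‖) := by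
    have e : ‖aeval T r x‖ ^ 2 = ‖inner 𝕜 (aeval T r x) (aeval T r x)‖ := by
      rw [inner_self_eq_norm_sq_to_K, norm_pow, RCLike.norm_ofReal, abs_norm]
    rw [e, h1]
    refine (norm_add_le _ _).trans (add_le_add ?_ ?_)
    · refine (norm_inner_le_norm _ _).trans ?_
      rw [hzy, norm_lanczosProd_smul A y hy]
      exact mul_le_mul_of_nonneg_right (norm_aeval_apply_le hA hx _ hD hr) (lanczosProd_nonneg A y j)
    · exact (norm_inner_le_norm _ _).trans (mul_le_mul_of_nonneg_left hq (norm_nonneg _))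
  have h3 : ‖aeval T r x‖ ≤ (lanczosProd A y j * S + K) * ‖x - y‖ := by
    rcases (norm_nonneg (aeval T r x)).eq_or_lt with h | h
    · rw [← h]
      have : 0 ≤ S := Finset.sum_nonneg fun i hi => div_nonneg
        (pow_nonneg (mul_nonneg zero_le_two (matrixSpectralNorm_nonneg A)) _)
        (lanczosProd_nonneg A x i)
      have hK : 0 ≤ K := pow_nonneg (mul_nonneg zero_le_two (matrixSpectralNorm_nonneg A)) _
      have := lanczosProd_nonneg A y j
      positivity
    · exact le_of_mul_le_mul_left (by nlinarith) h
  rw [← hzx, ← hzy]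
  have h4 : aeval T (rootPoly 𝕜 z) x - aeval T (rootPoly 𝕜 z') y =
      aeval T (rootPoly 𝕜 z') (x - y) - aeval T r x := by
    rw [hrx, map_sub]; abel
  rw [h4]
  calc _ ≤ ‖aeval T (rootPoly 𝕜 z') (x - y)‖ + ‖aeval T r x‖ := norm_sub_le _ _
    _ ≤ K * ‖x - y‖ + (lanczosProd A y j * S + K) * ‖x - y‖ := add_le_add hq h3
    _ = _ := by ring

theorem norm_lanczosVec_of_pos (hx : ‖x‖ = 1) {j : ℕ} (h : 0 < lanczosProd A x j) :
    ‖lanczosVec A x j‖ = 1 := by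
  have := norm_lanczosProd_smul A x hx j
  rw [norm_smul, RCLike.norm_ofReal, abs_of_pos h] at this
  exact mul_left_cancel₀ h.ne' (by rw [this, mul_one])

/-- The coefficient `α_j` is Lipschitz where the products `β_0 ⋯ β_{i-1}`, `i ≤ j`, are bounded
below. -/
theorem abs_alpha_sub_le (hA : A.IsHermitian) (hx : ‖x‖ = 1) (hy : ‖y‖ = 1) {j : ℕ} {ω m : ℝ}
    (hω : 0 < ω) (hωA : ω ≤ matrixSpectralNorm A) (hm : 0 < m)
    (hDx : ∀ i ≤ j, ω ^ i * m ≤ lanczosProd A x i) (hDy : ∀ i ≤ j, ω ^ i * m ≤ lanczosProd A y i) :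
    |RCLike.re (inner 𝕜 (Matrix.toEuclideanCLM (n := Fin n) (𝕜 := 𝕜) A (lanczosVec A x j))
        (lanczosVec A x j)) -
      RCLike.re (inner 𝕜 (Matrix.toEuclideanCLM (n := Fin n) (𝕜 := 𝕜) A (lanczosVec A y j))
        (lanczosVec A y j))| ≤
      6 * matrixSpectralNorm A * (2 * matrixSpectralNorm A / ω) ^ j / m * ‖x - y‖ := by
  -- Normalizing divides by the smaller product. That same product multiplies the sum in the bound
  -- for the unnormalized vectors and cancels there, which leaves a single factor 1/m.
  wlog hxy : lanczosProd A y j ≤ lanczosProd A x j generalizing x y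
  · rw [abs_sub_comm, norm_sub_rev]
    exact this hy hx hDy hDx (le_of_not_ge hxy)
  refine (abs_re_inner_apply_sub_le _ (norm_lanczosVec_le A x hx j)
    (norm_lanczosVec_le A y hy j)).trans ?_
  change 2 * matrixSpectralNorm A * _ ≤ _
  set R := matrixSpectralNorm A
  have hR : 0 < R := hω.trans_le hωA
  set Y := 2 * R / ω
  have hY : 2 ≤ Y := by rw [le_div_iff₀ hω]; linarith
  have hDpos : ∀ i ≤ j, 0 < lanczosProd A x i := fun i hi =>
    lt_of_lt_of_le (by positivity) (hDx i hi)
  have hDypos : 0 < lanczosProd A y j := lt_of_lt_of_le (by positivity) (hDy j le_rfl)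
  have hratio : ∀ i {d : ℝ}, ω ^ i * m ≤ d → (2 * R) ^ i / d ≤ Y ^ i / m := by
    intro i d hd
    rw [div_pow, div_div]
    exact div_le_div_of_nonneg_left (by positivity) (by positivity) hd
  have hS : ∑ i ∈ Finset.range j, (2 * R) ^ i / lanczosProd A x i ≤ Y ^ j / m := by
    calc _ ≤ ∑ i ∈ Finset.range j, Y ^ i / m := Finset.sum_le_sum fun i hi =>
          hratio i (hDx i (Finset.mem_range.1 hi).le)
      _ = (∑ i ∈ Finset.range j, Y ^ i) / m := by rw [Finset.sum_div]
      _ ≤ _ := by gcongr; exact sum_range_pow_le hY j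
  have h1 := norm_lanczosProd_smul_sub_le hA hx hy (fun i hi => hDpos i hi.le)
  have h2 := mul_norm_sub_le_norm_smul_sub_smul (𝕜 := 𝕜) hDypos hxy
    (norm_lanczosVec_of_pos hx (hDpos j le_rfl)) (norm_lanczosVec_of_pos hy hDypos)
  have h3 : (2 * R) ^ j ≤ lanczosProd A y j * (Y ^ j / m) :=
    (div_le_iff₀' hDypos).1 (hratio j (hDy j le_rfl))
  have h4 : ‖lanczosVec A x j - lanczosVec A y j‖ ≤ 3 * (Y ^ j / m) * ‖x - y‖ := by
    refine le_of_mul_le_mul_left (h2.trans (h1.trans ?_)) hDypos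
    calc _ ≤ (lanczosProd A y j * (Y ^ j / m) + 2 * (lanczosProd A y j * (Y ^ j / m))) *
          ‖x - y‖ := by gcongr
      _ = _ := by ring
  calc 2 * R * ‖lanczosVec A x j - lanczosVec A y j‖ ≤ 2 * R * (3 * (Y ^ j / m) * ‖x - y‖) := by
        gcongr
    _ = _ := by ring

/-- The coefficient `β_j` is Lipschitz where the product `β_0 ⋯ β_{j-1}` is bounded below. -/
theorem abs_norm_lanczosDir_sub_le (hA : A.IsHermitian) (hx : ‖x‖ = 1) (hy : ‖y‖ = 1) {j : ℕ}
    {ω m : ℝ} (hω : 0 < ω) (hm : 0 < m) (hDx : ω ^ j * m ≤ lanczosProd A x j) :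
    |‖lanczosDir A x j‖ - ‖lanczosDir A y j‖| ≤
      3 * matrixSpectralNorm A * (2 * matrixSpectralNorm A / ω) ^ j / m * ‖x - y‖ := by
  have h1 := abs_lanczosProd_sub_le hA hx hy j
  have h2 := abs_lanczosProd_sub_le hA hx hy (j + 1)
  have h3 := norm_lanczosDir_le A y hy j
  have hR := matrixSpectralNorm_nonneg A
  set R := matrixSpectralNorm A
  have hDpos : 0 < lanczosProd A x j := lt_of_lt_of_le (by positivity) hDx
  have e : ∀ x, lanczosProd A x (j + 1) = lanczosProd A x j * ‖lanczosDir A x j‖ := fun x =>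
    Finset.prod_range_succ _ _
  rw [e, e, pow_succ] at h2
  have h4 : lanczosProd A x j * |‖lanczosDir A x j‖ - ‖lanczosDir A y j‖| ≤
      3 * R * (2 * R) ^ j * ‖x - y‖ := by
    rw [← abs_of_pos hDpos, ← abs_mul]
    -- Since β_j = D_{j+1}/D_j, the Lipschitz bounds for the two products suffice, and only D_j(x)
    -- is divided by.
    have e2 : lanczosProd A x j * (‖lanczosDir A x j‖ - ‖lanczosDir A y j‖) =
        (lanczosProd A x j * ‖lanczosDir A x j‖ - lanczosProd A y j * ‖lanczosDir A y j‖) -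
        (lanczosProd A x j - lanczosProd A y j) * ‖lanczosDir A y j‖ := by ring
    rw [e2]
    refine (abs_sub _ _).trans ?_
    rw [abs_mul (lanczosProd A x j - lanczosProd A y j), abs_norm]
    calc _ ≤ (2 * R) ^ j * (2 * R) * ‖x - y‖ + (2 * R) ^ j * ‖x - y‖ * R := by gcongr
      _ = _ := by ring
  have h5 : (2 * R) ^ j / lanczosProd A x j ≤ (2 * R / ω) ^ j / m := by
    rw [div_pow, div_div]
    exact div_le_div_of_nonneg_left (by positivity) (by positivity) hDx
  calc |‖lanczosDir A x j‖ - ‖lanczosDir A y j‖|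
      ≤ 3 * R * (2 * R) ^ j * ‖x - y‖ / lanczosProd A x j := (le_div_iff₀' hDpos).2 h4
    _ = 3 * R * ((2 * R) ^ j / lanczosProd A x j) * ‖x - y‖ := by ring
    _ ≤ 3 * R * ((2 * R / ω) ^ j / m) * ‖x - y‖ := by gcongr
    _ = _ := by ring

end Lipschitz

/-! ### Mass of a random unit vector on a set of eigenvectors. -/

section Gaussian

theorem lintegral_exp_neg_sum_sq {n : ℕ} (b : OrthonormalBasis (Fin n) ℝ (EuclideanSpace ℝ (Fin n)))
    {c : Fin n → ℝ} (hc : ∀ a, 0 < c a) :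
    ∫⁻ x : EuclideanSpace ℝ (Fin n), ENNReal.ofReal (Real.exp (-∑ a, c a * (inner ℝ (b a) x) ^ 2)) =
      ENNReal.ofReal (∏ a, Real.sqrt (Real.pi / c a)) := by
  have h1 : ∀ φ : EuclideanSpace ℝ (Fin n) → ℝ≥0∞, Measurable φ →
      ∫⁻ x, φ (b.repr x) = ∫⁻ x : Fin n → ℝ, φ (WithLp.toLp 2 x) := fun φ hφ => by
    rw [b.measurePreserving_repr.lintegral_comp hφ,
      (PiLp.volume_preserving_toLp (Fin n)).lintegral_comp hφ]
  have h2 := h1 (fun x => ENNReal.ofReal (Real.exp (-∑ a, c a * (x a) ^ 2))) (by fun_prop)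
  simp only [OrthonormalBasis.repr_apply_apply] at h2
  rw [h2]
  have h3 : ∀ x : Fin n → ℝ, Real.exp (-∑ a, c a * (x a) ^ 2) =
      ∏ a, Real.exp (-c a * (x a) ^ 2) := by
    intro x
    rw [← Real.exp_sum, ← Finset.sum_neg_distrib]
    simp_rw [neg_mul]
  simp_rw [h3]
  have hint : Integrable (fun x : Fin n → ℝ => ∏ a, Real.exp (-c a * (x a) ^ 2)) volume := by
    rw [volume_pi]
    exact Integrable.fintype_prod (f := fun a (t : ℝ) => Real.exp (-c a * t ^ 2))
      fun a => integrable_exp_neg_mul_sq (hc a)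
  rw [← ofReal_integral_eq_lintegral_ofReal hint
    (.of_forall fun x => Finset.prod_nonneg fun _ _ => (Real.exp_pos _).le),
    integral_fintype_prod_volume_eq_prod (fun a (t : ℝ) => Real.exp (-c a * t ^ 2))]
  simp_rw [integral_gaussian]

/-- Polar coordinates; the radial integral will cancel and is never evaluated. -/
theorem lintegral_sphere_mul_radial {n : ℕ} (hn : 0 < n)
    {φ : Metric.sphere (0 : EuclideanSpace ℝ (Fin n)) 1 → ℝ≥0∞} (hφ : Measurable φ)
    {ψ : ℝ → ℝ≥0∞} (hψ : Measurable ψ) :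
    ∫⁻ x : ({0}ᶜ : Set (EuclideanSpace ℝ (Fin n))),
        φ (homeomorphUnitSphereProd _ x).1 * ψ ‖x.1‖ ∂(volume.comap Subtype.val) =
      (∫⁻ s, φ s ∂(volume : Measure (EuclideanSpace ℝ (Fin n))).toSphere) *
        ∫⁻ r : Ioi (0 : ℝ), ψ r ∂(Measure.volumeIoiPow (Module.finrank ℝ (EuclideanSpace ℝ (Fin n)) - 1)) := by
  have : Nonempty (Fin n) := ⟨⟨0, hn⟩⟩
  rw [← lintegral_prod_mul (g := fun r : Ioi (0 : ℝ) => ψ r) hφ.aemeasurable (hψ.comp measurable_subtype_coe).aemeasurable]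
  have := (volume : Measure (EuclideanSpace ℝ (Fin n))).measurePreserving_homeomorphUnitSphereProd.lintegral_comp_emb
      (Homeomorph.measurableEmbedding _) (fun p => φ p.1 * ψ p.2)
  simpa using this

/-- A cone on which a quadratic form is small has small measure on the sphere. -/
theorem unifSphere_quadForm_le {n : ℕ} (hn : 0 < n)
    (b : OrthonormalBasis (Fin n) ℝ (EuclideanSpace ℝ (Fin n))) {μ : Fin n → ℝ}
    (hμ : ∀ a, 0 ≤ μ a) {θ : ℝ} (hθ : θ < 1) :
    unifSphere n {u | ∑ a, μ a * (inner ℝ (b a) u.1) ^ 2 ≤ θ} ≤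
      ENNReal.ofReal (∏ a, (Real.sqrt (1 - θ + μ a))⁻¹) := by
  have : Nonempty (Fin n) := ⟨⟨0, hn⟩⟩
  set C : Set (Metric.sphere (0 : EuclideanSpace ℝ (Fin n)) 1) :=
    {u | ∑ a, μ a * (inner ℝ (b a) u.1) ^ 2 ≤ θ}
  have hC : MeasurableSet C := (isClosed_le (by fun_prop) continuous_const).measurableSet
  set ψ : ℝ → ℝ≥0∞ := fun r => ENNReal.ofReal (Real.exp (-r ^ 2))
  have hψ : Measurable ψ := by fun_prop
  set I := ∫⁻ r : Ioi (0 : ℝ), ψ r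
    ∂(Measure.volumeIoiPow (Module.finrank ℝ (EuclideanSpace ℝ (Fin n)) - 1))
  set σ := (volume : Measure (EuclideanSpace ℝ (Fin n))).toSphere
  have hnorm : ∀ x : EuclideanSpace ℝ (Fin n), ‖x‖ ^ 2 = ∑ a, 1 * (inner ℝ (b a) x) ^ 2 := by
    intro x
    rw [← b.sum_sq_norm_inner_right x]
    simp
  have hsub : ∀ φ : EuclideanSpace ℝ (Fin n) → ℝ≥0∞,
      ∫⁻ x : ({0}ᶜ : Set (EuclideanSpace ℝ (Fin n))), φ x ∂(volume.comap Subtype.val) =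
        ∫⁻ x, φ x := by
    intro φ
    rw [lintegral_subtype_comap (measurableSet_singleton _).compl, restrict_compl_singleton]
  have huniv : σ univ * I = ENNReal.ofReal (∏ a : Fin n, Real.sqrt Real.pi) := by
    have h1 := lintegral_sphere_mul_radial hn (φ := fun _ => 1) measurable_const hψ
    rw [lintegral_const, one_mul] at h1
    rw [← h1]
    simp only [one_mul]
    rw [hsub fun x => ψ ‖x‖]
    simp only [ψ, hnorm]
    rw [lintegral_exp_neg_sum_sq b (fun _ => one_pos)]
    simp
  have hCI : σ C * I ≤ ENNReal.ofReal (∏ a, Real.sqrt (Real.pi / (1 - θ + μ a))) := by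
    have h1 := lintegral_sphere_mul_radial hn (φ := C.indicator 1) (measurable_one.indicator hC) hψ
    rw [lintegral_indicator_one hC] at h1
    rw [← h1, ← lintegral_exp_neg_sum_sq b (fun a => by linarith [hμ a]), ← hsub]
    refine lintegral_mono fun x => ?_
    by_cases hx : (homeomorphUnitSphereProd _ x).1 ∈ C
    · rw [indicator_of_mem hx, Pi.one_apply, one_mul]
      -- Chernoff bound: on the cone, where the form is at most θ‖x‖², one has exp(-‖x‖²) ≤
      -- exp(-(1-θ)‖x‖² - form), a Gaussian that can be integrated over the whole space.
      refine ENNReal.ofReal_le_ofReal (Real.exp_le_exp.2 (neg_le_neg ?_))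
      have hx0 : ‖x.1‖ ≠ 0 := norm_ne_zero_iff.2 x.2
      have h2 : ∑ a, μ a * (inner ℝ (b a) x.1) ^ 2 ≤ θ * ‖x.1‖ ^ 2 := by
        have h3 : ∑ a, μ a * (inner ℝ (b a) (homeomorphUnitSphereProd _ x).1.1) ^ 2 ≤ θ := hx
        simp only [homeomorphUnitSphereProd_apply_fst_coe, inner_smul_right, mul_pow, inv_pow] at h3
        have h4 : ∑ a, μ a * ((‖x.1‖ ^ 2)⁻¹ * (inner ℝ (b a) x.1) ^ 2) =
            (∑ a, μ a * (inner ℝ (b a) x.1) ^ 2) / ‖x.1‖ ^ 2 := by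
          rw [Finset.sum_div]
          refine Finset.sum_congr rfl fun a _ => by ring
        rw [h4, div_le_iff₀ (by positivity)] at h3
        exact h3
      have h5 : ∑ a, (1 - θ + μ a) * (inner ℝ (b a) x.1) ^ 2 =
          (1 - θ) * ‖x.1‖ ^ 2 + ∑ a, μ a * (inner ℝ (b a) x.1) ^ 2 := by
        rw [hnorm, Finset.mul_sum, ← Finset.sum_add_distrib]
        refine Finset.sum_congr rfl fun a _ => by ring
      rw [h5]
      linarith
    · rw [indicator_of_notMem hx, zero_mul]
      exact zero_le
  have hσ0 : σ univ ≠ 0 := by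
    simpa only [ne_eq, Measure.measure_univ_eq_zero] using Measure.toSphere_ne_zero _
  have hprod : 0 < ∏ a : Fin n, Real.sqrt Real.pi :=
    Finset.prod_pos fun _ _ => Real.sqrt_pos.2 Real.pi_pos
  have hI0 : I ≠ 0 := by
    rintro h
    rw [h, mul_zero] at huniv
    exact (ENNReal.ofReal_pos.2 hprod).ne huniv
  have hIt : I ≠ ∞ := by
    rintro h
    rw [h, ENNReal.mul_top hσ0] at huniv
    exact ENNReal.ofReal_ne_top huniv.symm
  have hσt : σ univ ≠ ∞ := measure_ne_top _ _
  calc unifSphere n C = σ C / σ univ := by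
        rw [unifSphere, Measure.smul_apply, smul_eq_mul, mul_comm, div_eq_mul_inv]
    _ = σ C * I / (σ univ * I) := (ENNReal.mul_div_mul_right _ _ hI0 hIt).symm
    _ ≤ ENNReal.ofReal (∏ a, Real.sqrt (Real.pi / (1 - θ + μ a))) /
        ENNReal.ofReal (∏ a : Fin n, Real.sqrt Real.pi) := by
        rw [huniv]; gcongr
    _ = _ := by
        rw [← ENNReal.ofReal_div_of_pos hprod, ← Finset.prod_div_distrib]
        congr 2 with a
        rw [Real.sqrt_div Real.pi_pos.le, div_div_cancel_left' (Real.sqrt_pos.2 Real.pi_pos).ne']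

/-- The right side is at least (1 + μ)(1 - θ). Convexity of exp with exp(2/3) ≤ 2 bounds the first
factor below, and θ ≤ 1/4 the second. With θ = δ/4 this produces the exponent δn/6. -/
theorem exp_le_one_sub_add {μ θ : ℝ} (hμ0 : 0 ≤ μ) (hμ1 : μ ≤ 1) (hθ0 : 0 ≤ θ) (hθ1 : θ ≤ 1 / 4) :
    Real.exp (2 / 3 * μ - 4 / 3 * θ) ≤ 1 - θ + μ := by
  have h1 : Real.exp (-(4 / 3 * θ)) ≤ 1 - θ := by
    rw [Real.exp_neg]
    have h2 := Real.add_one_le_exp (4 / 3 * θ)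
    rw [inv_le_comm₀ (Real.exp_pos _) (by linarith)]
    refine le_trans ?_ h2
    rw [inv_le_iff_one_le_mul₀ (by linarith)]
    nlinarith
  have h3 : Real.exp (2 / 3) ≤ 2 := by
    refine le_of_pow_le_pow_left₀ (n := 3) (by norm_num) (by norm_num) ?_
    rw [← Real.exp_nat_mul]
    have := Real.exp_one_lt_d9
    calc Real.exp ((3 : ℕ) * (2 / 3)) = Real.exp 1 ^ 2 := by
          rw [← Real.exp_nat_mul]; norm_num
      _ ≤ 2.7182818286 ^ 2 := by gcongr
      _ ≤ 2 ^ 3 := by norm_num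
  have h4 : Real.exp (2 / 3 * μ) ≤ 1 + μ := by
    have := convexOn_exp.2 (mem_univ (0 : ℝ)) (mem_univ (2 / 3 : ℝ)) (sub_nonneg.2 hμ1) hμ0
      (by ring)
    simp only [smul_eq_mul, mul_zero, zero_add, Real.exp_zero, mul_one] at this
    rw [mul_comm]
    nlinarith
  rw [sub_eq_add_neg, Real.exp_add]
  calc _ ≤ (1 + μ) * (1 - θ) := mul_le_mul h4 h1 (Real.exp_pos _).le (by linarith)
    _ ≤ 1 - θ + μ := by nlinarith

/-- The map `ℝⁿ → 𝕜ⁿ` given by coordinatewise inclusion. -/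
noncomputable def realVec (𝕜 : Type*) [RCLike 𝕜] {n : ℕ} (x : EuclideanSpace ℝ (Fin n)) :
    EuclideanSpace 𝕜 (Fin n) :=
  WithLp.toLp 2 fun i => ((x i : ℝ) : 𝕜)

theorem norm_realVec (𝕜 : Type*) [RCLike 𝕜] {n : ℕ} (x : EuclideanSpace ℝ (Fin n)) :
    ‖realVec 𝕜 x‖ = ‖x‖ := by
  rw [EuclideanSpace.norm_eq, EuclideanSpace.norm_eq]
  simp [realVec]

theorem realVec_sub (𝕜 : Type*) [RCLike 𝕜] {n : ℕ} (x y : EuclideanSpace ℝ (Fin n)) :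
    realVec 𝕜 x - realVec 𝕜 y = realVec 𝕜 (x - y) := by
  ext i; simp [realVec]

/-- Diagonalization over `ℝ` of the quadratic form `x ↦ ∑_{i ∈ S} |⟨e_i, x⟩|²` on `ℝⁿ`. -/
theorem exists_diag_sum_norm_inner_sq {𝕜 : Type*} [RCLike 𝕜] {n : ℕ}
    (e : OrthonormalBasis (Fin n) 𝕜 (EuclideanSpace 𝕜 (Fin n))) (S : Finset (Fin n)) :
    ∃ (b : OrthonormalBasis (Fin n) ℝ (EuclideanSpace ℝ (Fin n))) (μ : Fin n → ℝ),
      (∀ a, 0 ≤ μ a) ∧ (∀ a, μ a ≤ 1) ∧ ∑ a, μ a = S.card ∧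
      ∀ x, ∑ i ∈ S, ‖inner 𝕜 (e i) (realVec 𝕜 x)‖ ^ 2 = ∑ a, μ a * (inner ℝ (b a) x) ^ 2 := by
  -- The sphere is real but the eigenvectors may be complex, so coordinates in the eigenbasis are
  -- not real orthonormal coordinates. The real part of the projection matrix gives the same form on
  -- ℝⁿ; its trace is still the cardinality of S and its eigenvalues lie in [0, 1].
  set G : Matrix (Fin n) (Fin n) ℝ :=
    Matrix.of fun a c => ∑ i ∈ S, RCLike.re (starRingEnd 𝕜 (e i a) * e i c)
  have hG : G.IsHermitian := by
    ext a c
    simp only [G, Matrix.conjTranspose_apply, Matrix.of_apply, star_trivial]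
    refine Finset.sum_congr rfl fun i _ => ?_
    rw [← RCLike.conj_re, map_mul, RCLike.conj_conj, mul_comm]
  have hQ : ∀ x, ∑ i ∈ S, ‖inner 𝕜 (e i) (realVec 𝕜 x)‖ ^ 2 =
      inner ℝ x (Matrix.toEuclideanCLM (n := Fin n) (𝕜 := ℝ) G x) := by
    intro x
    rw [Matrix.inner_toEuclideanCLM]
    simp only [dotProduct, Matrix.mulVec, G, Matrix.of_apply, Finset.sum_mul, Finset.mul_sum]
    have h1 : ∀ i, ‖inner 𝕜 (e i) (realVec 𝕜 x)‖ ^ 2 =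
        ∑ a, ∑ c, x a * (RCLike.re (starRingEnd 𝕜 (e i a) * e i c) * x c) := by
      intro i
      have h2 : inner 𝕜 (e i) (realVec 𝕜 x) = ∑ a, ((x a : ℝ) : 𝕜) * starRingEnd 𝕜 (e i a) := by
        simp [PiLp.inner_apply, realVec, RCLike.inner_apply]
      have h3 : ((‖inner 𝕜 (e i) (realVec 𝕜 x)‖ ^ 2 : ℝ) : 𝕜) =
          ∑ a, ∑ c, (x a : 𝕜) * ((starRingEnd 𝕜 (e i a) * e i c) * (x c : 𝕜)) := by
        rw [RCLike.ofReal_pow, ← RCLike.mul_conj, h2, map_sum, Finset.sum_mul_sum]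
        refine Finset.sum_congr rfl fun a _ => Finset.sum_congr rfl fun c _ => ?_
        rw [map_mul, RCLike.conj_conj, RCLike.conj_ofReal]
        ring
      have h4 := congrArg RCLike.re h3
      rw [RCLike.ofReal_re, map_sum] at h4
      rw [h4]
      refine Finset.sum_congr rfl fun a _ => ?_
      rw [map_sum]
      refine Finset.sum_congr rfl fun c _ => ?_
      rw [RCLike.re_ofReal_mul, RCLike.re_mul_ofReal]
    simp_rw [h1]
    rw [Finset.sum_comm]
    refine Finset.sum_congr rfl fun a _ => ?_
    rw [Finset.sum_comm]
  set b := hG.eigenvectorBasis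
  have hdiag : ∀ x, ∑ i ∈ S, ‖inner 𝕜 (e i) (realVec 𝕜 x)‖ ^ 2 =
      ∑ a, hG.eigenvalues a * (inner ℝ (b a) x) ^ 2 := by
    intro x
    rw [hQ, ← b.sum_inner_mul_inner]
    refine Finset.sum_congr rfl fun a _ => ?_
    rw [← hG.inner_toEuclideanCLM_left, hG.toEuclideanCLM_eigenvectorBasis, inner_smul_left,
      real_inner_comm]
    simp only [RCLike.ofReal_real_eq_id, id, conj_trivial, b]
    ring
  have hself : ∀ a, hG.eigenvalues a = ∑ i ∈ S, ‖inner 𝕜 (e i) (realVec 𝕜 (b a))‖ ^ 2 := by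
    intro a
    rw [hdiag, Finset.sum_eq_single a]
    · simp
    · intro c _ hc
      rw [b.inner_eq_zero hc]
      simp
    · simp
  refine ⟨b, hG.eigenvalues, fun a => ?_, fun a => ?_, ?_, hdiag⟩
  · rw [hself]; positivity
  · rw [hself]
    calc _ ≤ ∑ i, ‖inner 𝕜 (e i) (realVec 𝕜 (b a))‖ ^ 2 :=
          Finset.sum_le_sum_of_subset_of_nonneg (Finset.subset_univ _) fun _ _ _ => by positivity
      _ = 1 := by rw [e.sum_sq_norm_inner_right, norm_realVec, b.norm_eq_one, one_pow]
  · have h1 := hG.trace_eq_sum_eigenvalues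
    simp only [RCLike.ofReal_real_eq_id, id] at h1
    rw [← h1, Matrix.trace]
    simp only [Matrix.diag_apply, G, Matrix.of_apply]
    rw [Finset.sum_comm]
    have h2 : ∀ i, ∑ a, RCLike.re (starRingEnd 𝕜 (e i a) * e i a) = 1 := by
      intro i
      have h3 := e.norm_eq_one i
      have h4 := EuclideanSpace.norm_sq_eq (e i)
      rw [h3] at h4
      rw [one_pow] at h4
      rw [h4]
      refine Finset.sum_congr rfl fun a _ => ?_
      rw [RCLike.conj_mul, ← RCLike.ofReal_pow, RCLike.ofReal_re]
    simp_rw [h2]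
    simp

/-- With high probability, a uniform random real unit vector has mass at least `δ / 4` on a given
set of at least `δ n` vectors of an orthonormal basis of `𝕜ⁿ`. -/
theorem unifSphere_sum_norm_inner_sq_le {𝕜 : Type*} [RCLike 𝕜] {n : ℕ} (hn : 0 < n)
    (e : OrthonormalBasis (Fin n) 𝕜 (EuclideanSpace 𝕜 (Fin n))) (S : Finset (Fin n)) {δ : ℝ}
    (hδ0 : 0 ≤ δ) (hS : δ * n ≤ S.card) :
    unifSphere n {u | ∑ i ∈ S, ‖inner 𝕜 (e i) (startVec 𝕜 u)‖ ^ 2 ≤ δ / 4} ≤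
      ENNReal.ofReal (Real.exp (-(δ * n / 6))) := by
  obtain ⟨b, μ, hμ0, hμ1, hμS, hQ⟩ := exists_diag_sum_norm_inner_sq e S
  have hn' : (0 : ℝ) < n := by exact_mod_cast hn
  have hδ1 : δ ≤ 1 := by
    have h1 : (S.card : ℝ) ≤ n := by
      exact_mod_cast (Finset.card_le_univ S).trans (by simp)
    exact le_of_mul_le_mul_right (by linarith) hn'
  have h1 := unifSphere_quadForm_le hn b hμ0 (show δ / 4 < 1 by linarith)
  have hset : {u : Metric.sphere (0 : EuclideanSpace ℝ (Fin n)) 1 |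
      ∑ i ∈ S, ‖inner 𝕜 (e i) (startVec 𝕜 u)‖ ^ 2 ≤ δ / 4} =
      {u | ∑ a, μ a * (inner ℝ (b a) u.1) ^ 2 ≤ δ / 4} := by
    ext u
    simp only [mem_ofPred_eq]
    rw [← hQ u.1]
    rfl
  rw [hset]
  refine h1.trans (ENNReal.ofReal_le_ofReal ?_)
  calc ∏ a, (Real.sqrt (1 - δ / 4 + μ a))⁻¹
      ≤ ∏ a, Real.exp (-(1 / 3 * μ a) + δ / 6) := by
        refine Finset.prod_le_prod (fun a _ => inv_nonneg.2 (Real.sqrt_nonneg _)) fun a _ => ?_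
        have h2 := exp_le_one_sub_add (hμ0 a) (hμ1 a) (by linarith : 0 ≤ δ / 4) (by linarith)
        rw [inv_le_comm₀ (Real.sqrt_pos.2 (by linarith [hμ0 a])) (Real.exp_pos _), ← Real.exp_neg]
        refine Real.le_sqrt_of_sq_le ?_
        rw [← Real.exp_nat_mul]
        refine le_trans (le_of_eq ?_) h2
        congr 1
        push_cast
        ring
    _ = Real.exp (-(1 / 3 * S.card) + n * (δ / 6)) := by
        rw [← Real.exp_sum, Finset.sum_add_distrib, Finset.sum_neg_distrib, ← Finset.mul_sum, hμS]
        simp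
    _ ≤ _ := Real.exp_le_exp.2 (by linarith)

end Gaussian

/-! ### Lower bounds for β_0⋯β_{j-1} by a net of root vectors. -/

/-- Telescoping; the factor M on the left avoids an exponent one less than the cardinality. -/
theorem mul_abs_prod_sub_prod_le {ι : Type*} (s : Finset ι) {a b : ι → ℝ} {M : ℝ}
    (ha : ∀ i, |a i| ≤ M) (hb : ∀ i, |b i| ≤ M) (hM : 0 ≤ M) :
    M * |∏ i ∈ s, a i - ∏ i ∈ s, b i| ≤ M ^ s.card * ∑ i ∈ s, |a i - b i| := by
  classical
  induction s using Finset.induction_on with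
  | empty => simp
  | insert c s hc ih =>
    rw [Finset.prod_insert hc, Finset.prod_insert hc, Finset.sum_insert hc,
      Finset.card_insert_of_notMem hc, pow_succ]
    have h1 : |∏ i ∈ s, b i| ≤ M ^ s.card := by
      rw [Finset.abs_prod]
      exact (Finset.prod_le_prod (fun _ _ => abs_nonneg _) fun i _ => hb i).trans_eq
        (Finset.prod_const M)
    have e : a c * ∏ i ∈ s, a i - b c * ∏ i ∈ s, b i =
        a c * (∏ i ∈ s, a i - ∏ i ∈ s, b i) + (a c - b c) * ∏ i ∈ s, b i := by ring
    calc M * |a c * ∏ i ∈ s, a i - b c * ∏ i ∈ s, b i|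
        ≤ M * (|a c| * |∏ i ∈ s, a i - ∏ i ∈ s, b i| + |a c - b c| * |∏ i ∈ s, b i|) := by
          rw [e]
          gcongr
          refine (abs_add_le _ _).trans ?_
          rw [abs_mul, abs_mul]
      _ = |a c| * (M * |∏ i ∈ s, a i - ∏ i ∈ s, b i|) + M * (|a c - b c| * |∏ i ∈ s, b i|) := by
          ring
      _ ≤ M * (M ^ s.card * ∑ i ∈ s, |a i - b i|) + M * (|a c - b c| * M ^ s.card) := by
          refine add_le_add (mul_le_mul (ha c) ih (by positivity) hM) (by gcongr)
      _ = _ := by ring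

section Net
open Polynomial

variable {𝕜 : Type*} [RCLike 𝕜] {n : ℕ} {A : Matrix (Fin n) (Fin n) 𝕜}

theorem eval_rootPoly {j : ℕ} (z : Fin j → ℝ) (t : ℝ) :
    (rootPoly 𝕜 z).eval (t : 𝕜) = ((∏ l, (t - z l) : ℝ) : 𝕜) := by
  rw [rootPoly, eval_prod, RCLike.ofReal_prod]
  refine Finset.prod_congr rfl fun l _ => ?_
  rw [eval_sub, eval_X, eval_C, RCLike.ofReal_sub]

theorem norm_aeval_rootPoly_sub_le (hA : A.IsHermitian) {j : ℕ} {z z' : Fin j → ℝ} {η : ℝ}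
    (hR : 0 < matrixSpectralNorm A) (hη : 0 ≤ η)
    (hz : ∀ l, |z l| ≤ matrixSpectralNorm A) (hz' : ∀ l, |z' l| ≤ matrixSpectralNorm A)
    (hzz' : ∀ l, |z l - z' l| ≤ 2 * matrixSpectralNorm A * η) (x : EuclideanSpace 𝕜 (Fin n)) :
    ‖aeval (Matrix.toEuclideanCLM (n := Fin n) (𝕜 := 𝕜) A) (rootPoly 𝕜 z) x -
      aeval (Matrix.toEuclideanCLM (n := Fin n) (𝕜 := 𝕜) A) (rootPoly 𝕜 z') x‖ ≤
      (2 * matrixSpectralNorm A) ^ j * (j * η) * ‖x‖ := by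
  rw [← sub_apply, ← map_sub]
  refine (sq_le_sq₀ (norm_nonneg _) (by positivity)).1 ?_
  rw [hA.norm_sq_aeval, mul_pow, ← hA.eigenvectorBasis.sum_sq_norm_inner_right, Finset.mul_sum]
  refine Finset.sum_le_sum fun i _ => ?_
  gcongr
  rw [eval_sub, eval_rootPoly, eval_rootPoly, ← RCLike.ofReal_sub, RCLike.norm_ofReal]
  have hl := hA.abs_eigenvalues_le i
  set R := matrixSpectralNorm A
  have hb : ∀ y : ℝ, |y| ≤ R → |hA.eigenvalues i - y| ≤ 2 * R := fun y hy =>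
    (abs_sub _ _).trans (by linarith)
  have h1 := mul_abs_prod_sub_prod_le Finset.univ (a := fun l => hA.eigenvalues i - z l)
    (b := fun l => hA.eigenvalues i - z' l) (fun l => hb _ (hz l)) (fun l => hb _ (hz' l))
    (by positivity)
  have h2 : ∑ l, |(hA.eigenvalues i - z l) - (hA.eigenvalues i - z' l)| ≤ j * (2 * R * η) := by
    calc _ ≤ ∑ _l : Fin j, 2 * R * η := Finset.sum_le_sum fun l _ => by
          rw [show (hA.eigenvalues i - z l) - (hA.eigenvalues i - z' l) = -(z l - z' l) by ring,
            abs_neg]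
          exact hzz' l
      _ = _ := by simp
  refine le_of_mul_le_mul_left (h1.trans ?_) (by positivity : 0 < 2 * R)
  rw [Finset.card_univ, Fintype.card_fin]
  calc (2 * R) ^ j * _ ≤ (2 * R) ^ j * (j * (2 * R * η)) := by gcongr
    _ = _ := by ring

/-- A grid point of `[-R, R]^j` with distinct coordinates. -/
noncomputable def gridPoint (R : ℝ) (j N : ℕ) (a : Fin j → Fin N) (l : Fin j) : ℝ :=
  R * (-1 + 2 * (((j * (a l).1 + l.1 : ℕ) : ℝ) / (j * N)))

theorem gridPoint_frac {j N : ℕ} (a : Fin N) (l : Fin j) :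
    (a : ℝ) / N ≤ ((j * a.1 + l.1 : ℕ) : ℝ) / (j * N) ∧
      ((j * a.1 + l.1 : ℕ) : ℝ) / (j * N) ≤ (a + 1) / N := by
  have hj : (0 : ℝ) < j := by exact_mod_cast l.pos
  have hN : (0 : ℝ) < N := by exact_mod_cast a.pos
  have hl : (l : ℝ) ≤ j := by exact_mod_cast l.2.le
  constructor
  · rw [div_le_div_iff₀ hN (by positivity)]
    push_cast
    nlinarith [mul_nonneg (Nat.cast_nonneg (α := ℝ) l.1) hN.le]
  · rw [div_le_div_iff₀ (by positivity) hN]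
    push_cast
    nlinarith [mul_le_mul_of_nonneg_right hl hN.le]

theorem abs_gridPoint_le {R : ℝ} (hR : 0 ≤ R) {j N : ℕ} (a : Fin j → Fin N) (l : Fin j) :
    |gridPoint R j N a l| ≤ R := by
  obtain ⟨h1, h2⟩ := gridPoint_frac (a l) l
  have hN : (0 : ℝ) < N := by exact_mod_cast (a l).pos
  have h3 : ((a l : ℝ) + 1) / N ≤ 1 := by
    rw [div_le_one hN]; exact_mod_cast (a l).2
  have h4 : (0 : ℝ) ≤ (a l : ℝ) / N := by positivity
  rw [gridPoint]
  set c := ((j * (a l).1 + l.1 : ℕ) : ℝ) / (j * N)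
  rw [abs_mul, abs_of_nonneg hR]
  exact mul_le_of_le_one_right hR (abs_le.2 ⟨by linarith, by linarith⟩)

/-- The numerators j·a_l + l have different residues modulo j. Distinctness is needed because
equidistribution speaks of sets of roots, without multiplicity. -/
theorem gridPoint_injective {R : ℝ} (hR : 0 < R) {j N : ℕ} (a : Fin j → Fin N) :
    Function.Injective (gridPoint R j N a) := by
  intro l l' h
  have hj : (0 : ℝ) < j := by exact_mod_cast l.pos
  have hN : (0 : ℝ) < N := by exact_mod_cast (a l).pos
  have h1 := mul_left_cancel₀ hR.ne' h
  have h2 : ((j * (a l).1 + l.1 : ℕ) : ℝ) / (j * N) = ((j * (a l').1 + l'.1 : ℕ) : ℝ) / (j * N) := by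
    linarith
  rw [div_left_inj' (by positivity)] at h2
  have h3 : j * (a l).1 + l.1 = j * (a l').1 + l'.1 := by exact_mod_cast h2
  have h4 := congrArg (· % j) h3
  simp only [Nat.mul_add_mod] at h4
  rw [Nat.mod_eq_of_lt l.2, Nat.mod_eq_of_lt l'.2] at h4
  exact Fin.ext h4

theorem exists_gridPoint_near {R : ℝ} (hR : 0 < R) {j N : ℕ} (hN : 0 < N) {z : Fin j → ℝ}
    (hz : ∀ l, |z l| ≤ R) :
    ∃ a : Fin j → Fin N, ∀ l, |z l - gridPoint R j N a l| ≤ 2 * R * (1 / N) := by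
  have hN' : (0 : ℝ) < N := by exact_mod_cast hN
  have hcell : ∀ s : ℝ, 0 ≤ s → s ≤ 1 → ∃ a : Fin N, (a : ℝ) / N ≤ s ∧ s ≤ ((a : ℝ) + 1) / N := by
    intro s hs0 hs1
    by_cases h : ⌊s * N⌋₊ < N
    · refine ⟨⟨_, h⟩, ?_, ?_⟩
      · rw [div_le_iff₀ hN']; exact Nat.floor_le (by positivity)
      · rw [le_div_iff₀ hN']; exact (Nat.lt_floor_add_one _).le
    · have h1 : (N : ℝ) ≤ s * N := (Nat.le_floor_iff (by positivity)).1 (not_lt.1 h)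
      have h2 : s = 1 := le_antisymm hs1 (le_of_mul_le_mul_right (by linarith) hN')
      refine ⟨⟨N - 1, by omega⟩, ?_, ?_⟩
      · rw [h2, div_le_one hN']; simp
      · rw [h2, le_div_iff₀ hN', one_mul, Nat.cast_sub (by omega : 1 ≤ N)]; simp
  have h1 : ∀ l, ∃ a : Fin N, (a : ℝ) / N ≤ (z l + R) / (2 * R) ∧
      (z l + R) / (2 * R) ≤ ((a : ℝ) + 1) / N := fun l => by
    obtain ⟨h2, h3⟩ := abs_le.1 (hz l)
    exact hcell _ (div_nonneg (by linarith) (by linarith))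
      (by rw [div_le_one (by linarith)]; linarith)
  choose a ha1 ha2 using h1
  refine ⟨a, fun l => ?_⟩
  obtain ⟨h3, h4⟩ := gridPoint_frac (a l) l
  rw [gridPoint]
  set c := ((j * (a l).1 + l.1 : ℕ) : ℝ) / (j * N)
  have h5 : z l - R * (-1 + 2 * c) = 2 * R * ((z l + R) / (2 * R) - c) := by
    field_simp; ring
  rw [h5, abs_mul, abs_of_pos (by positivity : 0 < 2 * R)]
  refine mul_le_mul_of_nonneg_left ?_ (by positivity)
  have h6 : ((a l : ℝ) + 1) / N = (a l : ℝ) / N + 1 / N := add_div _ _ _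
  have := ha1 l
  have := ha2 l
  exact abs_le.2 ⟨by linarith, by linarith⟩

theorem startVec_eq_realVec {n : ℕ} (u : Metric.sphere (0 : EuclideanSpace ℝ (Fin n)) 1) :
    startVec 𝕜 u = realVec 𝕜 u.1 := rfl

theorem norm_startVec {n : ℕ} (u : Metric.sphere (0 : EuclideanSpace ℝ (Fin n)) 1) :
    ‖startVec 𝕜 u‖ = 1 := by
  rw [startVec_eq_realVec, norm_realVec]; simp

/-- Equidistribution for the root set gives at least δn eigenvalues where the polynomial is at least
ω^j in modulus. A small value of ‖p(A)u‖ then forces mass at most δ/4 on their eigenvectors. -/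
theorem unifSphere_norm_aeval_rootPoly_le (hn : 0 < n) (hA : A.IsHermitian) {δ ω : ℝ} {k j : ℕ}
    (hδ : 0 < δ) (hω : 0 < ω) (hequi : Equidistributed hA.eigenvalues δ ω k) (hj : 0 < j)
    (hjk : j ≤ k) {z : Fin j → ℝ} (hz : Function.Injective z) :
    unifSphere n {u | ‖aeval (Matrix.toEuclideanCLM (n := Fin n) (𝕜 := 𝕜) A) (rootPoly 𝕜 z)
      (startVec 𝕜 u)‖ ≤ ω ^ j * (Real.sqrt δ / 2)} ≤ ENNReal.ofReal (Real.exp (-(δ * n / 6))) := by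
  classical
  set T : Finset ℝ := Finset.univ.image z
  have hTcard : T.card = j := by
    rw [Finset.card_image_of_injective _ hz, Finset.card_univ, Fintype.card_fin]
  have hTne : T.Nonempty := Finset.card_pos.1 (by omega)
  set S : Finset (Fin n) := Finset.univ.filter fun i => hA.eigenvalues i ∉ T ∧
    Real.log ω ≤ (1 / (T.card : ℝ)) * ∑ t ∈ T, Real.log |hA.eigenvalues i - t|
  have hS : δ * n ≤ S.card := by
    have := hequi T hTne (by omega)
    rw [Set.ncard_eq_toFinset_card'] at this
    convert this using 3
    ext i
    simp [S]
  have hSprod : ∀ i ∈ S, ω ^ j ≤ ∏ l, |hA.eigenvalues i - z l| := by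
    intro i hi
    obtain ⟨-, hiT, hlog⟩ := Finset.mem_filter.1 hi
    have hne : ∀ l, |hA.eigenvalues i - z l| ≠ 0 := fun l h => hiT (by
      rw [sub_eq_zero.1 (abs_eq_zero.1 h)]
      exact Finset.mem_image_of_mem z (Finset.mem_univ l))
    rw [Finset.sum_image hz.injOn, ← Real.log_prod fun l _ => hne l, hTcard, one_div,
      le_inv_mul_iff₀ (by exact_mod_cast hj), ← Real.log_pow] at hlog
    exact (Real.log_le_log_iff (by positivity)
      (Finset.prod_pos fun l _ => lt_of_le_of_ne (abs_nonneg _) (hne l).symm)).1 hlog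
  refine (measure_mono ?_).trans
    (unifSphere_sum_norm_inner_sq_le (𝕜 := 𝕜) hn hA.eigenvectorBasis S hδ.le hS)
  intro u hu
  simp only [mem_ofPred_eq] at hu ⊢
  have h1 := (sq_le_sq₀ (norm_nonneg _) (by positivity)).2 hu
  rw [hA.norm_sq_aeval, mul_pow, div_pow, Real.sq_sqrt hδ.le] at h1
  have h2 : (ω ^ j) ^ 2 * ∑ i ∈ S, ‖inner 𝕜 (hA.eigenvectorBasis i) (startVec 𝕜 u)‖ ^ 2 ≤
      (ω ^ j) ^ 2 * (δ / 2 ^ 2) := by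
    refine le_trans ?_ h1
    rw [Finset.mul_sum]
    calc _ ≤ ∑ i ∈ S, ‖(rootPoly 𝕜 z).eval (hA.eigenvalues i : 𝕜)‖ ^ 2 *
          ‖inner 𝕜 (hA.eigenvectorBasis i) (startVec 𝕜 u)‖ ^ 2 := by
          refine Finset.sum_le_sum fun i hi => ?_
          gcongr
          rw [norm_eval_rootPoly]
          exact hSprod i hi
      _ ≤ _ := Finset.sum_le_sum_of_subset_of_nonneg (Finset.subset_univ _)
          fun _ _ _ => by positivity
  have h3 := le_of_mul_le_mul_left h2 (by positivity)
  linarith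

theorem unifSphere_lanczosProd_lt_le (hn : 0 < n) (hA : A.IsHermitian) {δ ω : ℝ} {k j N : ℕ}
    (hδ : 0 < δ) (hω : 0 < ω) (hR : 0 < matrixSpectralNorm A)
    (hequi : Equidistributed hA.eigenvalues δ ω k) (hj : 0 < j)
    (hjk : j ≤ k) (hN : 0 < N)
    (hjN : 4 * j * (2 * matrixSpectralNorm A / ω) ^ j / Real.sqrt δ ≤ N) :
    unifSphere n {u | lanczosProd A (startVec 𝕜 u) j < ω ^ j * (Real.sqrt δ / 4)} ≤
      ENNReal.ofReal (N ^ j * Real.exp (-(δ * n / 6))) := by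
  set R := matrixSpectralNorm A
  have hN' : (0 : ℝ) < N := by exact_mod_cast hN
  have hsδ : 0 < Real.sqrt δ := Real.sqrt_pos.2 hδ
  -- The error of rounding the roots to the grid fits between the thresholds √δ/4 and √δ/2.
  have herr : (2 * R) ^ j * (j * (1 / N)) ≤ ω ^ j * (Real.sqrt δ / 4) := by
    rw [div_le_iff₀ hsδ, div_pow] at hjN
    have h1 : 4 * j * ((2 * R) ^ j / ω ^ j) = 4 * (j * (2 * R) ^ j) / ω ^ j := by ring
    rw [h1, div_le_iff₀ (by positivity)] at hjN
    have h2 : (2 * R) ^ j * (j * (1 / N)) = j * (2 * R) ^ j / N := by ring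
    rw [h2, div_le_iff₀ hN']
    linarith
  have hsub : {u | lanczosProd A (startVec 𝕜 u) j < ω ^ j * (Real.sqrt δ / 4)} ⊆
      ⋃ a : Fin j → Fin N, {u | ‖aeval (Matrix.toEuclideanCLM (n := Fin n) (𝕜 := 𝕜) A)
        (rootPoly 𝕜 (gridPoint R j N a)) (startVec 𝕜 u)‖ ≤ ω ^ j * (Real.sqrt δ / 2)} := by
    intro u hu
    have hu : lanczosProd A (startVec 𝕜 u) j < ω ^ j * (Real.sqrt δ / 4) := hu
    obtain ⟨z, hz, hzx⟩ := exists_rootPoly_aeval_eq_lanczosProd_smul hA (startVec 𝕜 u) j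
    obtain ⟨a, ha⟩ := exists_gridPoint_near hR hN hz
    refine mem_iUnion.2 ⟨a, ?_⟩
    have h1 := norm_aeval_rootPoly_sub_le hA hR (by positivity) hz
      (abs_gridPoint_le hR.le a) ha (startVec 𝕜 u)
    rw [norm_startVec, mul_one] at h1
    have h2 := norm_lanczosProd_smul A (startVec 𝕜 u) (norm_startVec u) j
    rw [← hzx] at h2
    have h3 := norm_sub_norm_le
      (aeval (Matrix.toEuclideanCLM (n := Fin n) (𝕜 := 𝕜) A) (rootPoly 𝕜 (gridPoint R j N a))
        (startVec 𝕜 u))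
      (aeval (Matrix.toEuclideanCLM (n := Fin n) (𝕜 := 𝕜) A) (rootPoly 𝕜 z) (startVec 𝕜 u))
    rw [norm_sub_rev] at h3
    simp only [mem_ofPred_eq]
    linarith
  calc _ ≤ ∑ a : Fin j → Fin N, unifSphere n {u |
        ‖aeval (Matrix.toEuclideanCLM (n := Fin n) (𝕜 := 𝕜) A)
        (rootPoly 𝕜 (gridPoint R j N a)) (startVec 𝕜 u)‖ ≤ ω ^ j * (Real.sqrt δ / 2)} :=
        (measure_mono hsub).trans (measure_iUnion_fintype_le _ _)
    _ ≤ ∑ _a : Fin j → Fin N, ENNReal.ofReal (Real.exp (-(δ * n / 6))) :=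
        Finset.sum_le_sum fun a _ => unifSphere_norm_aeval_rootPoly_le hn hA hδ hω hequi hj hjk
          (gridPoint_injective hR a)
    _ = _ := by
        rw [Finset.sum_const, Finset.card_univ, Fintype.card_fun, Fintype.card_fin,
          Fintype.card_fin, nsmul_eq_mul, ENNReal.ofReal_mul (by positivity),
          ENNReal.ofReal_pow hN'.le, ENNReal.ofReal_natCast]
        push_cast
        rfl

/-- The crude N^j ≤ exp(jN) suffices: the hypotheses give jN ≤ δn'/16, leaving δn'(1/6 - 1/16), well
above δn'/1600. -/
theorem pow_mul_exp_le {δ Z n' : ℝ} {j N : ℕ} (hδ : 0 < δ)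
    (hZn : 16 / 3 * Z ^ 2 ≤ δ ^ 2 * n') (hj : (j : ℝ) ≤ Z / 16) (hN : (N : ℝ) ≤ 5 * Z / δ) :
    (N : ℝ) ^ j * Real.exp (-(δ * n' / 6)) ≤ Real.exp (-((min δ (1 / 50)) ^ 2 / 32) * n') := by
  have hj0 : (0 : ℝ) ≤ j := Nat.cast_nonneg j
  have hN0 : (0 : ℝ) ≤ N := Nat.cast_nonneg N
  have hn' : 0 ≤ n' := by
    by_contra h
    push Not at h
    nlinarith [sq_nonneg Z, pow_pos hδ 2]
  have h1 : (N : ℝ) ^ j ≤ Real.exp (j * N) := by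
    rw [Real.exp_nat_mul]
    have := Real.add_one_le_exp (N : ℝ)
    gcongr
    linarith
  have h2 : (j : ℝ) * N ≤ δ * n' / 16 := by
    calc (j : ℝ) * N ≤ Z / 16 * (5 * Z / δ) := mul_le_mul hj hN hN0 (by linarith)
      _ = 5 * Z ^ 2 / 16 / δ := by ring
      _ ≤ δ * n' / 16 := by
        rw [div_le_iff₀ hδ]
        nlinarith
  have h3 : (min δ (1 / 50)) ^ 2 ≤ δ * (1 / 50) := by
    rw [sq]
    exact mul_le_mul (min_le_left _ _) (min_le_right _ _) (by positivity) hδ.le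
  calc _ ≤ Real.exp (j * N) * Real.exp (-(δ * n' / 6)) := by gcongr
    _ = Real.exp (j * N + -(δ * n' / 6)) := (Real.exp_add _ _).symm
    _ ≤ _ := Real.exp_le_exp.2 (by nlinarith [mul_nonneg hδ.le hn'])

end Net

/-! ### Concentration of the Ritz values. -/

theorem IsMedian.mem_Icc {Ω : Type*} [MeasurableSpace Ω] {μ : Measure Ω} {X : Ω → ℝ} {m lo hi : ℝ}
    (hm : IsMedian μ X m) (hlo : ∀ u, lo ≤ X u) (hhi : ∀ u, X u ≤ hi) : m ∈ Icc lo hi := by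
  have hne : ∀ s : Set Ω, 1 / 2 ≤ μ s → s.Nonempty := by
    intro s hs
    refine nonempty_of_measure_ne_zero (μ := μ) ?_
    have : (0 : ℝ≥0∞) < 1 / 2 := by simp
    exact (this.trans_le hs).ne'
  obtain ⟨u, hu⟩ := hne _ hm.1
  obtain ⟨v, hv⟩ := hne _ hm.2
  exact ⟨(hlo u).trans hu, le_trans hv (hhi v)⟩

section Concentration

variable {𝕜 : Type*} [RCLike 𝕜] {n : ℕ} {A : Matrix (Fin n) (Fin n) 𝕜}

theorem abs_lanczosAlpha_le (A : Matrix (Fin n) (Fin n) 𝕜) (i : ℕ)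
    (u : Metric.sphere (0 : EuclideanSpace ℝ (Fin n)) 1) :
    |lanczosAlpha A i u| ≤ matrixSpectralNorm A := by
  have hv := norm_lanczosVec_le A (startVec 𝕜 u) (norm_startVec u) i
  refine (RCLike.abs_re_le_norm _).trans ((norm_inner_le_norm _ _).trans ?_)
  refine (mul_le_of_le_one_right (norm_nonneg _) hv).trans ?_
  exact (ContinuousLinearMap.le_opNorm _ _).trans (mul_le_of_le_one_right (norm_nonneg _) hv)

theorem lanczosBeta_nonneg (A : Matrix (Fin n) (Fin n) 𝕜) (i : ℕ)
    (u : Metric.sphere (0 : EuclideanSpace ℝ (Fin n)) 1) : 0 ≤ lanczosBeta A i u := norm_nonneg _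

theorem lanczosBeta_le (A : Matrix (Fin n) (Fin n) 𝕜) (i : ℕ)
    (u : Metric.sphere (0 : EuclideanSpace ℝ (Fin n)) 1) :
    lanczosBeta A i u ≤ matrixSpectralNorm A :=
  norm_lanczosDir_le A (startVec 𝕜 u) (norm_startVec u) i

theorem norm_startVec_sub (u v : Metric.sphere (0 : EuclideanSpace ℝ (Fin n)) 1) :
    ‖startVec 𝕜 u - startVec 𝕜 v‖ = dist u v := by
  rw [startVec_eq_realVec, startVec_eq_realVec, realVec_sub, norm_realVec, Subtype.dist_eq,
    dist_eq_norm]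

theorem Equidistributed.le_one {Λ : Fin n → ℝ} {δ ω : ℝ} {k : ℕ} (h : Equidistributed Λ δ ω k)
    (hk : 1 ≤ k) (hn : 0 < n) : δ ≤ 1 := by
  have h1 := h {0} (by simp) (by simpa using hk)
  have hn' : (0 : ℝ) < n := by exact_mod_cast hn
  refine le_of_mul_le_mul_right ((h1.trans ?_).trans_eq (one_mul _).symm) hn'
  have := Set.ncard_le_card (α := Fin n) {i : Fin n | Λ i ∉ ({0} : Finset ℝ) ∧
    Real.log ω ≤ (1 / ((({0} : Finset ℝ).card : ℕ) : ℝ)) * ∑ t ∈ ({0} : Finset ℝ), Real.log |Λ i - t|}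
  rw [Nat.card_eq_fintype_card, Fintype.card_fin] at this
  exact_mod_cast this

/-- The test set {0} yields an eigenvalue of modulus at least ω. -/
theorem Equidistributed.le_matrixSpectralNorm (hA : A.IsHermitian) {δ ω : ℝ} {k : ℕ}
    (h : Equidistributed hA.eigenvalues δ ω k) (hk : 1 ≤ k) (hn : 0 < n) (hδ : 0 < δ)
    (hω : 0 < ω) : ω ≤ matrixSpectralNorm A := by
  have h1 := h {0} (by simp) (by simpa using hk)
  have hn' : (0 : ℝ) < n := by exact_mod_cast hn
  have h2 : (0 : ℝ) < _ := lt_of_lt_of_le (by positivity) h1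
  have h3 := Set.nonempty_of_ncard_ne_zero (ne_of_gt (Nat.cast_pos.1 h2))
  obtain ⟨i, hi0, hi⟩ := h3
  simp only [Finset.card_singleton, Nat.cast_one, div_one, one_mul, Finset.sum_singleton,
    sub_zero] at hi
  have hi0 : hA.eigenvalues i ≠ 0 := by simpa using hi0
  exact ((Real.log_le_log_iff hω (abs_pos.2 hi0)).1 hi).trans (hA.abs_eigenvalues_le i)

/-- The weights satisfy 2/3 + 2·(1/6) = 1; they are chosen so that the α and β deviations will have
the same exponent. -/
theorem mem_or_of_le_norm_ritzValues_sub {k : ℕ} {a b : ℕ → ℝ} {s : ℝ} (hs : 0 < s)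
    {u : Metric.sphere (0 : EuclideanSpace ℝ (Fin n)) 1}
    (hu : s ≤ ‖ritzValues A k u - jacobiEigenvalues k a b‖) :
    (∃ i < k, 2 / 3 * s ≤ |lanczosAlpha A i u - a i|) ∨
      ∃ i, i + 1 < k ∧ s / 6 ≤ |lanczosBeta A i u - b i| := by
  by_contra h
  push Not at h
  have := norm_jacobiEigenvalues_sub_lt (k := k) (p := 2 / 3 * s) (q := s / 6) (by positivity)
    (by positivity) h.1 h.2
  exact absurd hu (not_le.2 (this.trans_eq (by ring)))

/-- Concentration of the Ritz values, given that the products `β_0 ⋯ β_{j-1}` are bounded below on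
a large set of starting vectors. -/
theorem unifSphere_ritzValues_le_of_good (hn : 0 < n) (hA : A.IsHermitian) {k : ℕ} (hk : 1 ≤ k)
    {ω m t e : ℝ} (hω : 0 < ω) (hωA : ω ≤ matrixSpectralNorm A) (hm : 0 < m) (ht : 0 < t)
    {a b : ℕ → ℝ} (ha : ∀ i, i < k → IsMedian (unifSphere n) (lanczosAlpha A i) (a i))
    (hb : ∀ i, i + 1 < k → IsMedian (unifSphere n) (lanczosBeta A i) (b i))
    (hG : unifSphere n {u | ∀ j < k, ω ^ j * m ≤ lanczosProd A (startVec 𝕜 u) j}ᶜ ≤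
      ENNReal.ofReal e) (he0 : 0 ≤ e) (he : e ≤ 1 / 4) :
    unifSphere n {u | t * matrixSpectralNorm A ≤ ‖ritzValues A k u - jacobiEigenvalues k a b‖} ≤
      ENNReal.ofReal (e + 16 * k * Real.exp
        (-(n * (t * m / (9 * (2 * matrixSpectralNorm A / ω) ^ (k - 1))) ^ 2 / 4))) := by
  set R := matrixSpectralNorm A
  have hR : 0 < R := hω.trans_le hωA
  set Y := 2 * R / ω
  have hY : 2 ≤ Y := by rw [le_div_iff₀ hω]; linarith
  set G : Set (Metric.sphere (0 : EuclideanSpace ℝ (Fin n)) 1) :=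
    {u | ∀ j < k, ω ^ j * m ≤ lanczosProd A (startVec 𝕜 u) j}
  set E := Real.exp (-(n * (t * m / (9 * Y ^ (k - 1))) ^ 2 / 4))
  have hG4 : unifSphere n Gᶜ ≤ 1 / 4 := hG.trans (by
    refine (ENNReal.ofReal_le_ofReal he).trans (le_of_eq ?_)
    rw [ENNReal.ofReal_div_of_pos (by norm_num)]
    simp)
  have hα : ∀ i ∈ Finset.range k, unifSphere n
      ({u | 2 / 3 * (t * R) ≤ |lanczosAlpha A i u - a i|} ∩ G) ≤ ENNReal.ofReal (8 * E) := by
    intro i hi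
    have hi := Finset.mem_range.1 hi
    have h1 := unifSphere_abs_sub_median_ge_le hn (f := lanczosAlpha A i) (m := a i)
      (τ := 2 / 3 * (t * R)) (κ := 6 * R * Y ^ (k - 1) / m) (G := G) (by positivity)
      (by positivity) hG4 (ha i hi) (fun u hu v hv => by
        have h2 := abs_alpha_sub_le hA (norm_startVec (𝕜 := 𝕜) u) (norm_startVec (𝕜 := 𝕜) v)
          hω hωA hm (fun l (hl : l ≤ i) => hu l (by omega)) (fun l hl => hv l (by omega))
        rw [norm_startVec_sub] at h2
        refine h2.trans ?_
        have : Y ^ i ≤ Y ^ (k - 1) := pow_le_pow_right₀ (by linarith) (by omega)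
        gcongr)
    refine h1.trans (le_of_eq ?_)
    congr 6
    field_simp
    norm_num
  have hβ : ∀ i ∈ Finset.range (k - 1), unifSphere n
      ({u | t * R / 6 ≤ |lanczosBeta A i u - b i|} ∩ G) ≤ ENNReal.ofReal (8 * E) := by
    intro i hi
    have hi := Finset.mem_range.1 hi
    have h1 := unifSphere_abs_sub_median_ge_le hn (f := lanczosBeta A i) (m := b i)
      -- Only β_i with i ≤ k - 2 occur, so Y ≥ 2 halves the Lipschitz constant at the exponent k -
      -- 1. Thus τ/κ is t·m/(9Y^(k-1)), as for the α_i.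
      (τ := t * R / 6) (κ := 3 / 2 * R * Y ^ (k - 1) / m) (G := G) (by positivity)
      (by positivity) hG4 (hb i (by omega)) (fun u hu v hv => by
        have h2 := abs_norm_lanczosDir_sub_le hA (norm_startVec (𝕜 := 𝕜) u)
          (norm_startVec (𝕜 := 𝕜) v) hω hm (hu i (by omega))
        rw [norm_startVec_sub] at h2
        refine h2.trans ?_
        have h3 : Y ^ (i + 1) ≤ Y ^ (k - 1) := pow_le_pow_right₀ (by linarith) (by omega)
        have h4 : 2 * Y ^ i ≤ Y ^ (k - 1) := by
          refine le_trans ?_ h3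
          rw [pow_succ, mul_comm]
          gcongr
        have h5 : 3 * R * Y ^ i ≤ 3 / 2 * R * Y ^ (k - 1) := by nlinarith
        gcongr)
    refine h1.trans (le_of_eq ?_)
    congr 6
    field_simp
    norm_num
  have hsub : {u | t * R ≤ ‖ritzValues A k u - jacobiEigenvalues k a b‖} ⊆
      Gᶜ ∪ ((⋃ i ∈ Finset.range k, ({u | 2 / 3 * (t * R) ≤ |lanczosAlpha A i u - a i|} ∩ G)) ∪
        ⋃ i ∈ Finset.range (k - 1), ({u | t * R / 6 ≤ |lanczosBeta A i u - b i|} ∩ G)) := by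
    intro u hu
    by_cases hg : u ∈ G
    · right
      rcases mem_or_of_le_norm_ritzValues_sub (by positivity) hu with ⟨i, hi, h⟩ | ⟨i, hi, h⟩
      · left
        exact mem_biUnion (Finset.mem_coe.2 (Finset.mem_range.2 hi)) ⟨h, hg⟩
      · right
        exact mem_biUnion (Finset.mem_coe.2 (Finset.mem_range.2 (by omega))) ⟨h, hg⟩
    · exact Or.inl hg
  have hE : 0 ≤ E := (Real.exp_pos _).le
  have hsum : unifSphere n {u | t * R ≤ ‖ritzValues A k u - jacobiEigenvalues k a b‖} ≤
      ENNReal.ofReal e + (k * ENNReal.ofReal (8 * E) + k * ENNReal.ofReal (8 * E)) := by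
    refine (measure_mono hsub).trans ((measure_union_le _ _).trans (add_le_add hG
      ((measure_union_le _ _).trans (add_le_add ?_ ?_))))
    · refine (measure_biUnion_finset_le _ _).trans ((Finset.sum_le_sum hα).trans (le_of_eq ?_))
      simp
    · refine (measure_biUnion_finset_le _ _).trans ((Finset.sum_le_sum hβ).trans ?_)
      rw [Finset.sum_const, Finset.card_range, nsmul_eq_mul]
      gcongr
      omega
  refine hsum.trans ?_
  have hk' : (k : ℝ≥0∞) * ENNReal.ofReal (8 * E) = ENNReal.ofReal (8 * k * E) := by
    rw [← ENNReal.ofReal_natCast, ← ENNReal.ofReal_mul (Nat.cast_nonneg k)]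
    congr 1
    ring
  rw [hk', ← ENNReal.ofReal_add (by positivity) (by positivity),
    ← ENNReal.ofReal_add he0 (by positivity)]
  exact ENNReal.ofReal_le_ofReal (by linarith)

theorem lanczosProd_zero (x : EuclideanSpace 𝕜 (Fin n)) : lanczosProd A x 0 = 1 := by
  simp [lanczosProd]

/-- With high probability, all the products `β_0 ⋯ β_{j-1}`, `j < k`, are bounded below. -/
theorem unifSphere_compl_good_le (hn : 0 < n) (hA : A.IsHermitian) {δ ω t : ℝ} {k : ℕ}
    (hk : 1 ≤ k) (hδ : 0 < δ) (hω : 0 < ω) (hequi : Equidistributed hA.eigenvalues δ ω k)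
    (ht0 : 0 < t) (ht : t ≤ 6)
    (hx : 1 ≤ 1 / 192 * (ω / (4 * matrixSpectralNorm A)) ^ (2 * k) * δ ^ 2 * t ^ 2 * n) :
    unifSphere n {u | ∀ j < k, ω ^ j * (Real.sqrt δ / 4) ≤ lanczosProd A (startVec 𝕜 u) j}ᶜ ≤
      ENNReal.ofReal (k * Real.exp (-((min δ (1 / 50)) ^ 2 / 32) * n)) := by
  have hωR := hequi.le_matrixSpectralNorm hA hk hn hδ hω
  have hδ1 := hequi.le_one hk hn
  set R := matrixSpectralNorm A
  have hR : 0 < R := hω.trans_le hωR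
  set Y := 2 * R / ω
  have hY : 2 ≤ Y := by rw [le_div_iff₀ hω]; linarith
  set Z := (2 * Y) ^ k
  have hZ4 : 4 ^ k ≤ Z := pow_le_pow_left₀ (by norm_num) (by linarith) k
  have hZ1 : 1 ≤ Z := le_trans (one_le_pow₀ (by norm_num)) hZ4
  have hsδ : 0 < Real.sqrt δ := Real.sqrt_pos.2 hδ
  have hZn : 16 / 3 * Z ^ 2 ≤ δ ^ 2 * n := by
    have h1 : (ω / (4 * R)) ^ (2 * k) = (Z ^ 2)⁻¹ := by
      simp only [Z, Y]
      rw [← pow_mul, mul_comm k 2, ← inv_pow]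
      congr 1
      field_simp
      norm_num
    rw [h1] at hx
    have h2 : t ^ 2 ≤ 36 := by nlinarith
    have h3 : 1 / 192 * (Z ^ 2)⁻¹ * δ ^ 2 * t ^ 2 * n ≤ 1 / 192 * (Z ^ 2)⁻¹ * δ ^ 2 * 36 * n := by
      gcongr
    have h4 : 1 ≤ (36 / 192 * (δ ^ 2 * n)) / Z ^ 2 := by
      refine (hx.trans h3).trans (le_of_eq ?_)
      rw [div_eq_mul_inv]; ring
    rw [le_div_iff₀ (by positivity)] at h4
    linarith
  have hbad : ∀ j ∈ Finset.Ico 1 k,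
      unifSphere n {u | lanczosProd A (startVec 𝕜 u) j < ω ^ j * (Real.sqrt δ / 4)} ≤
        ENNReal.ofReal (Real.exp (-((min δ (1 / 50)) ^ 2 / 32) * n)) := by
    intro j hj
    obtain ⟨hj1, hjk⟩ := Finset.mem_Ico.1 hj
    have hj0 : (0 : ℝ) < j := by exact_mod_cast hj1
    set N := ⌈4 * j * Y ^ j / Real.sqrt δ⌉₊
    have hN0 : 0 < N := Nat.ceil_pos.2 (by positivity)
    refine (unifSphere_lanczosProd_lt_le hn hA hδ hω hR hequi hj1 hjk.le hN0
      (Nat.le_ceil _)).trans (ENNReal.ofReal_le_ofReal ?_)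
    refine pow_mul_exp_le hδ hZn ?_ ?_
    · have h1 : ∀ i : ℕ, 4 * (i + 1) ≤ 4 ^ (i + 1) := by
        intro i
        induction i with
        | zero => norm_num
        | succ i ih => rw [pow_succ]; omega
      have h2 : 16 * j ≤ 4 ^ k := by
        have h3 := h1 (j - 1)
        rw [Nat.sub_add_cancel hj1] at h3
        calc 16 * j ≤ 4 ^ j * 4 := by omega
          _ = 4 ^ (j + 1) := (pow_succ _ _).symm
          _ ≤ 4 ^ k := Nat.pow_le_pow_right (by norm_num) hjk
      have h4 : (16 : ℝ) * j ≤ 4 ^ k := by exact_mod_cast h2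
      linarith
    · have h1 : j * Y ^ j ≤ Z := by
        have h2 : (j : ℝ) ≤ 2 ^ k := by
          exact_mod_cast hjk.le.trans Nat.lt_two_pow_self.le
        calc j * Y ^ j ≤ 2 ^ k * Y ^ k := by
              gcongr
              linarith
          _ = Z := (mul_pow _ _ _).symm
      have h3 : δ ≤ Real.sqrt δ := Real.le_sqrt_of_sq_le (by nlinarith)
      have h4 : 4 * j * Y ^ j / Real.sqrt δ ≤ 4 * Z / δ := by
        rw [mul_assoc]
        gcongr
      have h5 : 1 ≤ Z / δ := by rw [le_div_iff₀ hδ]; linarith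
      have h6 := (Nat.ceil_lt_add_one (by positivity : 0 ≤ 4 * j * Y ^ j / Real.sqrt δ)).le
      calc (N : ℝ) ≤ 4 * Z / δ + Z / δ := by linarith
        _ = _ := by ring
  have hsub : {u | ∀ j < k, ω ^ j * (Real.sqrt δ / 4) ≤ lanczosProd A (startVec 𝕜 u) j}ᶜ ⊆
      ⋃ j ∈ Finset.Ico 1 k,
        {u | lanczosProd A (startVec 𝕜 u) j < ω ^ j * (Real.sqrt δ / 4)} := by
    intro u hu
    simp only [mem_compl_iff, mem_ofPred_eq, not_forall, not_le] at hu
    obtain ⟨j, hjk, hj⟩ := hu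
    have hj1 : 1 ≤ j := by
      by_contra h
      have h0 : j = 0 := by omega
      subst h0
      rw [lanczosProd_zero, pow_zero, one_mul] at hj
      have : Real.sqrt δ ≤ 1 := Real.sqrt_le_one.2 hδ1
      linarith
    exact mem_biUnion (Finset.mem_coe.2 (Finset.mem_Ico.2 ⟨hj1, hjk⟩)) hj
  refine (measure_mono hsub).trans ((measure_biUnion_finset_le _ _).trans
    ((Finset.sum_le_sum hbad).trans ?_))
  rw [Finset.sum_const, Nat.card_Ico, nsmul_eq_mul, ENNReal.ofReal_mul (by positivity),
    ENNReal.ofReal_natCast]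
  gcongr
  omega

/-- The medians obey the same bounds as the coefficients, so α_i deviates by at most 2‖A‖ and β_i by
at most ‖A‖, below the thresholds when t > 6. -/
theorem ritzValues_event_eq_empty (hR : 0 < matrixSpectralNorm A) {k : ℕ} {a b : ℕ → ℝ} {t : ℝ}
    (ht : 6 < t) (ha : ∀ i, i < k → IsMedian (unifSphere n) (lanczosAlpha A i) (a i))
    (hb : ∀ i, i + 1 < k → IsMedian (unifSphere n) (lanczosBeta A i) (b i)) :
    {u | t * matrixSpectralNorm A ≤ ‖ritzValues A k u - jacobiEigenvalues k a b‖} = ∅ := by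
  refine eq_empty_iff_forall_notMem.2 fun u hu => ?_
  rcases mem_or_of_le_norm_ritzValues_sub (by nlinarith) hu with ⟨i, hi, h⟩ | ⟨i, hi, h⟩
  · have h1 := fun u => abs_le.1 (abs_lanczosAlpha_le A i u)
    obtain ⟨h2, h3⟩ := (ha i hi).mem_Icc (fun u => (h1 u).1) (fun u => (h1 u).2)
    have h4 : |lanczosAlpha A i u - a i| ≤ 2 * matrixSpectralNorm A :=
      abs_le.2 ⟨by linarith [(h1 u).1], by linarith [(h1 u).2]⟩
    nlinarith
  · obtain ⟨h2, h3⟩ := (hb i hi).mem_Icc (lanczosBeta_nonneg A i) (lanczosBeta_le A i)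
    have h4 : |lanczosBeta A i u - b i| ≤ matrixSpectralNorm A :=
      abs_le.2 ⟨by linarith [lanczosBeta_nonneg A i u], by linarith [lanczosBeta_le A i u]⟩
    nlinarith

/-- The comparison of the exponents, for `m = 1` if `k = 1` and `m = √δ / 4` if `k ≥ 2`. -/
theorem two_mul_exponent_le {δ ω R t m N : ℝ} {k : ℕ} (hk : 1 ≤ k) (hδ : 0 < δ) (hδ1 : δ ≤ 1)
    (hω : 0 < ω) (hωR : ω ≤ R) (hN : 0 ≤ N)
    (hm : (k = 1 ∧ m ^ 2 = 1) ∨ (2 ≤ k ∧ m ^ 2 = δ / 16)) :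
    2 * (1 / 192 * (ω / (4 * R)) ^ (2 * k) * δ ^ 2 * t ^ 2 * N) ≤
      N * (t * m / (9 * (2 * R / ω) ^ (k - 1))) ^ 2 / 4 := by
  have hR : 0 < R := hω.trans_le hωR
  obtain ⟨l, rfl⟩ : ∃ l, k = l + 1 := ⟨k - 1, by omega⟩
  rw [Nat.add_sub_cancel]
  set q := ω / R
  have hq0 : 0 < q := by positivity
  have hq1 : q ≤ 1 := by rw [div_le_one hR]; exact hωR
  set P := ((q / 2) ^ l) ^ 2
  have hP : 0 ≤ P := by positivity
  have e1 : (ω / (4 * R)) ^ (2 * (l + 1)) = P * (q / 2) ^ 2 / 4 ^ (l + 1) := by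
    have h1 : ω / (4 * R) = q / 2 / 2 := by simp only [q]; field_simp; norm_num
    rw [h1, div_pow, pow_mul' (q / 2), pow_succ (q / 2), mul_pow, pow_mul]
    norm_num
    exact Or.inl rfl
  have e2 : (t * m / (9 * (2 * R / ω) ^ l)) ^ 2 = t ^ 2 * m ^ 2 * P / 81 := by
    have h1 : 2 * R / ω = (q / 2)⁻¹ := by simp only [q]; field_simp
    rw [h1, inv_pow, div_pow, mul_pow, mul_pow, inv_pow]
    have : (q / 2) ^ l ≠ 0 := by positivity
    field_simp
    norm_num
    ring
  rw [e1, e2]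
  have hq2 : (q / 2) ^ 2 ≤ 1 / 4 := by nlinarith
  have hNtP : 0 ≤ N * t ^ 2 * P := by positivity
  have hδ2 : δ ^ 2 ≤ δ := by nlinarith
  have key : (q / 2) ^ 2 / 4 ^ (l + 1) * δ ^ 2 / 96 ≤ m ^ 2 / 324 := by
    rcases hm with ⟨hl, hm⟩ | ⟨hl, hm⟩
    · have h4 : (1 : ℝ) ≤ 4 ^ (l + 1) := one_le_pow₀ (by norm_num)
      have h5 : (q / 2) ^ 2 / 4 ^ (l + 1) ≤ 1 / 4 :=
        (div_le_self (by positivity) h4).trans hq2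
      have h6 : (q / 2) ^ 2 / 4 ^ (l + 1) * δ ^ 2 ≤ 1 / 4 * 1 :=
        mul_le_mul h5 (hδ2.trans hδ1) (by positivity) (by norm_num)
      rw [hm]; linarith
    · have h4 : (16 : ℝ) ≤ 4 ^ (l + 1) := by
        calc (16 : ℝ) = 4 ^ 2 := by norm_num
          _ ≤ 4 ^ (l + 1) := pow_le_pow_right₀ (by norm_num) hl
      have h5 : (q / 2) ^ 2 / 4 ^ (l + 1) ≤ 1 / 64 := by
        rw [div_le_iff₀ (by positivity)]; linarith
      have h6 : (q / 2) ^ 2 / 4 ^ (l + 1) * δ ^ 2 ≤ 1 / 64 * δ :=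
        mul_le_mul h5 hδ2 (by positivity) (by norm_num)
      rw [hm]; linarith
  calc _ = N * t ^ 2 * P * ((q / 2) ^ 2 / 4 ^ (l + 1) * δ ^ 2 / 96) := by ring
    _ ≤ N * t ^ 2 * P * (m ^ 2 / 324) := by gcongr
    _ = _ := by ring

end Concentration

-- The norm of a vector of `Fin k → ℝ` is the sup norm.
theorem proposition4p16 {𝕜 : Type*} [RCLike 𝕜] (n k : ℕ) (hk : 1 ≤ k) (hkn : k ≤ n)
    (A : Matrix (Fin n) (Fin n) 𝕜) (hA : A.IsHermitian)
    (δ ω : ℝ) (hδ : 0 < δ) (hω : 0 < ω)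
    (hequi : Equidistributed hA.eigenvalues δ ω k)
    (a b : ℕ → ℝ)
    (ha : ∀ i, i < k → IsMedian (unifSphere n) (lanczosAlpha A i) (a i))
    (hb : ∀ i, i + 1 < k → IsMedian (unifSphere n) (lanczosBeta A i) (b i))
    (t : ℝ) (ht : 0 < t) :
    unifSphere n {u | t * matrixSpectralNorm A ≤ ‖ritzValues A k u - jacobiEigenvalues k a b‖} ≤
      ENNReal.ofReal (4 * (k : ℝ) *
        (Real.exp (-((min δ (1 / 50)) ^ 2 / 32) * (n : ℝ)) +
          Real.exp (-(1 / 192) * (ω / (4 * matrixSpectralNorm A)) ^ (2 * k) *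
            δ ^ 2 * t ^ 2 * (n : ℝ)))) := by
  have hn : 0 < n := by omega
  have hωR := hequi.le_matrixSpectralNorm hA hk hn hδ hω
  have hδ1 := hequi.le_one hk hn
  have hR : 0 < matrixSpectralNorm A := hω.trans_le hωR
  have hk' : (1 : ℝ) ≤ k := by exact_mod_cast hk
  set x := 1 / 192 * (ω / (4 * matrixSpectralNorm A)) ^ (2 * k) * δ ^ 2 * t ^ 2 * (n : ℝ)
  have hxe : -(1 / 192) * (ω / (4 * matrixSpectralNorm A)) ^ (2 * k) * δ ^ 2 * t ^ 2 * (n : ℝ) =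
      -x := by simp only [x]; ring
  rw [hxe]
  set e₁ := Real.exp (-((min δ (1 / 50)) ^ 2 / 32) * (n : ℝ))
  have he₁ : 0 < e₁ := Real.exp_pos _
  have hex : 0 < Real.exp (-x) := Real.exp_pos _
  -- When the bound is not trivial, its failure to reach 1 supplies all that is needed: the bad set
  -- has measure at most 1/4, 4k exp(-x) ≤ 1, and x ≥ 1.
  by_cases htriv : 1 ≤ 4 * (k : ℝ) * (e₁ + Real.exp (-x))
  · refine (measure_mono (subset_univ _)).trans ?_
    rw [unifSphere_univ hn, ← ENNReal.ofReal_one]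
    exact ENNReal.ofReal_le_ofReal htriv
  push Not at htriv
  have hke₁ : k * e₁ ≤ 1 / 4 := by nlinarith
  have hkx : 4 * k * Real.exp (-x) ≤ 1 := by nlinarith
  have hx1 : 1 ≤ x := by
    by_contra h
    push Not at h
    have h1 : Real.exp (-1) < Real.exp (-x) := Real.exp_lt_exp.2 (by linarith)
    have h2 := Real.exp_neg_one_gt_d9
    nlinarith
  rcases lt_or_ge 6 t with ht6 | ht6
  · rw [ritzValues_event_eq_empty hR ht6 ha hb, measure_empty]
    exact zero_le
  obtain ⟨m, hm0, hmk, hG⟩ : ∃ m : ℝ, 0 < m ∧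
      ((k = 1 ∧ m ^ 2 = 1) ∨ (2 ≤ k ∧ m ^ 2 = δ / 16)) ∧
      unifSphere n {u | ∀ j < k, ω ^ j * m ≤ lanczosProd A (startVec 𝕜 u) j}ᶜ ≤
        ENNReal.ofReal (k * e₁) := by
    -- For k = 1 only the empty product occurs, so m = 1 and every u is good. The value √δ/4 would
    -- be too small for the exponent comparison there.
    rcases hk.eq_or_lt with h | h
    · refine ⟨1, one_pos, Or.inl ⟨h.symm, one_pow 2⟩, ?_⟩
      have : {u | ∀ j < k, ω ^ j * 1 ≤ lanczosProd A (startVec 𝕜 u) j}ᶜ = ∅ := by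
        refine compl_empty_iff.2 (eq_univ_of_forall fun u j hj => ?_)
        have h0 : j = 0 := by omega
        subst h0
        simp [lanczosProd_zero]
      rw [this, measure_empty]
      exact zero_le
    · exact ⟨Real.sqrt δ / 4, by positivity, Or.inr ⟨h, by
        rw [div_pow, Real.sq_sqrt hδ.le]; norm_num⟩,
        unifSphere_compl_good_le hn hA hk hδ hω hequi ht ht6 hx1⟩
  refine (unifSphere_ritzValues_le_of_good hn hA hk hω hωR hm0 ht ha hb hG (by positivity)
    hke₁).trans (ENNReal.ofReal_le_ofReal ?_)
  have h1 := two_mul_exponent_le (t := t) (N := n) hk hδ hδ1 hω hωR (Nat.cast_nonneg n) hmk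
  have h2 : Real.exp (-(n * (t * m / (9 * (2 * matrixSpectralNorm A / ω) ^ (k - 1))) ^ 2 / 4)) ≤
      Real.exp (-x) * Real.exp (-x) := by
    rw [← Real.exp_add]
    exact Real.exp_le_exp.2 (by linarith)
  -- One of the two factors exp(-x) absorbs 4k.
  calc _ ≤ k * e₁ + 16 * k * (Real.exp (-x) * Real.exp (-x)) := by gcongr
    _ = k * e₁ + 4 * (4 * k * Real.exp (-x)) * Real.exp (-x) := by ring
    _ ≤ k * e₁ + 4 * 1 * Real.exp (-x) := by gcongr
    _ ≤ 4 * k * (e₁ + Real.exp (-x)) := by nlinarith
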